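/- Fix an encoding of complex numbers by bit strings of some length $b$, that is, a function $\mathrm{val}:\{0,1\}^b\to\mathbb C$. Let $H$ be a Hamiltonian on $n$ qubits, i.e. a Hermitian $2^n\times 2^n$ matrix, with at most $d$ nonzero entries in any row or column, all of whose entries are represented by bit strings. $H$ is accessed through two unitary oracles, $$O_F|j,\ell\rangle=|j,f(j,\ell)\rangle,\qquad O_H|j,k,z\rangle=|j,k,z\oplus h(j,k)\rangle ,$$ where, for each row $j$, $f(j,\cdot)$ is a permutation of the basis labels such that the positions of all nonzero entries of row $j$ are among $f(j,0),f(j,1),\dots,f(j,\ell),\dots$ with $\ell<d$, and $\mathrm{val}(h(j,k))=H_{jk}$. A query algorithm is a sequence of oracle-independent unitaries on the oracle registers and a finite-dimensional workspace, interleaved with queries, each of which is one application of $O_F$, $O_F^{-1}$ or $O_H$. It simulates $H$ for time $t$ within error $\epsilon$ if the isometry that it induces on an input $|\psi\rangle$ with all other registers in a fixed initial state $|0\rangle$ is within $\epsilon$ in spectral norm of $|\psi\rangle|0\rangle\mapsto (e^{-iHt}|\psi\rangle)|0\rangle$. Theorem. A $d$-sparse Hamiltonian $H$ acting on $n$ qubits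 can be simulated for time $t\ge 0$ within error $\epsilon>0$ with $$O\left(\tau\,\frac{\log\tau}{\log\log\tau}+\log(1/\epsilon)\right)$$ queries, where $\tau:=t\|H\|_{\max}d$ and $\|H\|_{\max}=\max_{j,k}|H_{jk}|$. Here the constant in $O(\cdot)$ is absolute. The algorithm depends only on $n$, $d$, $t$, $\epsilon$, $\|H\|_{\max}$ and the encoding, and works for all $H$ and all oracles with these parameters. For $\tau<e^{e}$ the factor $\log\tau/\log\log\tau$ is read as its value at $\tau=e^{e}$, and $\log(1/\epsilon)$ is read as $\max\{1,\log(1/\epsilon)\}$. -/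

import Mathlib

namespace HamSim

open Matrix

/-- Computational basis labels of `n` qubits. -/
abbrev Label (n : ℕ) : Type := Fin (2 ^ n)

/-- Bit strings of length `b`, used to represent matrix entries. -/
abbrev Bits (b : ℕ) : Type := Fin b → Bool

/-- The max-norm: the largest modulus of a matrix entry. -/
noncomputable def maxNorm {n : ℕ} (H : Matrix (Label n) (Label n) ℂ) : ℝ :=
  ⨆ p : Label n × Label n, ‖H p.1 p.2‖

/-- At most `d` nonzero entries in any row and in any column. -/
def IsSparse {n : ℕ} (d : ℕ) (H : Matrix (Label n) (Label n) ℂ) : Prop :=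
  (∀ j, {k | H j k ≠ 0}.ncard ≤ d) ∧ (∀ k, {j | H j k ≠ 0}.ncard ≤ d)

/-- The classical data behind the two oracles: `f j ℓ` is the column index returned for row `j` and
index `ℓ` (the position oracle computes in place, so `f j` is a bijection), and `h j k` is the bit
string that represents the entry in row `j` and column `k`. -/
structure OracleData (n b : ℕ) where
  f : Label n → Equiv.Perm (Label n)
  h : Label n → Label n → Bits b

/-- The oracle data describe `H`, when a bit string `z` stands for the number `val z`: the positions
of the nonzero entries of row `j` are all listed among `f j 0, …, f j (d - 1)` (in any order, and
possibly together with positions of zero entries), and `h j k` represents `H j k`. -/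
structure OracleData.Specifies {n b : ℕ} (O : OracleData n b) (val : Bits b → ℂ) (d : ℕ)
    (H : Matrix (Label n) (Label n) ℂ) : Prop where
  position : ∀ j k, H j k ≠ 0 → ∃ ℓ : Label n, (ℓ : ℕ) < d ∧ O.f j ℓ = k
  value : ∀ j k, val (O.h j k) = H j k

/-- Basis labels `(j, k, z, w)` of the machine: two `n`-qubit registers, a register of `b` bits for
matrix entries, and a workspace with basis `W`. -/
abbrev Config (n b : ℕ) (W : Type) : Type := Label n × Label n × Bits b × W

/-- The kinds of query: the position oracle, its inverse, and the entry oracle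
(which is its own inverse). -/
inductive Query
  | posn
  | posnInv
  | entry

/-- The action of a query on basis labels:
`|j, ℓ⟩ ↦ |j, f j ℓ⟩`, its inverse, and `|j, k, z⟩ ↦ |j, k, z ⊕ h j k⟩`. -/
def OracleData.act {n b : ℕ} (O : OracleData n b) {W : Type} :
    Query → Config n b W → Config n b W
  | .posn, (j, l, z, w) => (j, O.f j l, z, w)
  | .posnInv, (j, k, z, w) => (j, (O.f j).symm k, z, w)
  | .entry, (j, k, z, w) => (j, k, fun i => xor (z i) (O.h j k i), w)

/-- The matrix of a query: it sends the basis vector `|y⟩` to `|O.act q y⟩`. -/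
def OracleData.gate {n b : ℕ} (O : OracleData n b) {W : Type} [DecidableEq W] (q : Query) :
    Matrix (Config n b W) (Config n b W) ℂ :=
  Matrix.of fun x y => if x = O.act q y then 1 else 0

/-- A quantum query algorithm: a finite-dimensional workspace with initial basis state `w₀`, a first
unitary, and a list of steps, each of them one query followed by one unitary. None of these data
depend on the oracles. -/
structure QueryAlgorithm (n b : ℕ) where
  W : Type
  [fintypeW : Fintype W]
  [decEqW : DecidableEq W]
  w₀ : W
  first : Matrix.unitaryGroup (Config n b W) ℂ
  steps : List (Query × Matrix.unitaryGroup (Config n b W) ℂ)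

attribute [instance] QueryAlgorithm.fintypeW QueryAlgorithm.decEqW

/-- The number of queries that the algorithm makes. -/
def QueryAlgorithm.queries {n b : ℕ} (A : QueryAlgorithm n b) : ℕ := A.steps.length

/-- The operator applied by the algorithm when it is run with given oracles
(the steps of the list are applied from left to right). -/
def QueryAlgorithm.run {n b : ℕ} (A : QueryAlgorithm n b) (O : OracleData n b) :
    Matrix (Config n b A.W) (Config n b A.W) ℂ :=
  A.steps.foldl (fun M s => (s.2 : Matrix (Config n b A.W) (Config n b A.W) ℂ) * O.gate s.1 * M)
    (A.first : Matrix (Config n b A.W) (Config n b A.W) ℂ)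

/-- The isometry `|ψ⟩ ↦ |ψ⟩|0⟩|0⟩|w₀⟩` that puts the input into the first register. -/
def QueryAlgorithm.embed {n b : ℕ} (A : QueryAlgorithm n b) :
    Matrix (Config n b A.W) (Label n) ℂ :=
  Matrix.of fun x j => if x = (j, 0, fun _ => false, A.w₀) then 1 else 0

/-- The spectral norm of a (possibly rectangular) matrix. -/
noncomputable def matSpectralNorm {m l : Type} [Fintype m] [Fintype l] [DecidableEq l]
    (M : Matrix m l ℂ) : ℝ :=
  ‖LinearMap.toContinuousLinearMap (Matrix.toEuclideanLin M)‖

/-- The time evolution `exp(-iHt)`. -/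
noncomputable def evolution {n : ℕ} (H : Matrix (Label n) (Label n) ℂ) (t : ℝ) :
    Matrix (Label n) (Label n) ℂ :=
  NormedSpace.exp ((-(Complex.I * (t : ℂ))) • H)

/-- Run with the given oracles on `|ψ⟩|0⟩`, the algorithm produces `exp(-iHt)|ψ⟩|0⟩` up to error `ε`
in spectral norm. -/
def QueryAlgorithm.Simulates {n b : ℕ} (A : QueryAlgorithm n b) (O : OracleData n b)
    (H : Matrix (Label n) (Label n) ℂ) (t ε : ℝ) : Prop :=
  matSpectralNorm (A.run O * A.embed - A.embed * evolution H t) ≤ ε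

/-- `τ · log τ / log log τ + log (1/ε)`. To make sense for all `τ ≥ 0` and `ε > 0`, the slowly
varying factor is frozen at its value for `τ = e ^ e` when `τ` is smaller than that, and the second
summand is replaced by `1` when it is smaller than `1`. -/
noncomputable def queryScale (τ ε : ℝ) : ℝ :=
  let τ' := max τ (Real.exp (Real.exp 1))
  τ * (Real.log τ' / Real.log (Real.log τ')) + max 1 (Real.log (1 / ε))

end HamSim

/-! The Hamiltonian is encoded in a quantum walk, and its exponential is extracted by quantum signal
processing.

Let `T = neighbours` send a row label to a uniform superposition of its listed columns, and let `S =
flip` exchange row and column while loading the matrix entry as an amplitude. The compression `A =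
T* S T` is then `H / (‖H‖_max D)` with `D = min d (2 ^ n)` (`sparse_eq_smul_compress`). The walk `W
= S (2 T T* - 1)` satisfies `(W + W*) T = 2 T A` (`walk_add_conjTranspose_mul_neighbours`), so a
polynomial in `(W + W*) / 2` acts on the range of `T` as the same polynomial in `A`.

Put `θ = t ‖H‖_max D`. Truncating the series of `exp (-iθ(W + W*)/2)` at order `K` and multiplying
by `W ^ K` gives a polynomial of degree at most `2K` in `W`. On the unit circle it barely exceeds
modulus one, so after slight damping `fejer_riesz` supplies a complementary polynomial, and
`exists_signalProcessing` factors the pair into `2K` controlled walk steps between fixed one-qubit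
unitaries. Then `K` applications of `W*` undo the shift.

The circuit induces an isometry whose compression to the initial ancilla state is within `ε² / 2` of
the unitary `exp (-iHt)`. By `norm_isometry_sub_sq_le` the isometry itself is then within `ε`,
without amplitude amplification. The series tail is at most `exp (eθ - K - 1)`, so `K = O(θ + log
(1/ε))` suffices. This is stronger than required, because the factor `log τ / log log τ` is at least
one. -/

namespace HamSim

open Polynomial

/-! ### Polynomials on the unit circle -/

/-- The conjugate reciprocal `z ^ N * conj (p (1 / conj z))` of a polynomial of degree at most `N`. -/
noncomputable def conjReflect (N : ℕ) (p : ℂ[X]) : ℂ[X] := (p.map (starRingEnd ℂ)).reflect N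

theorem coeff_zero_conjReflect (N : ℕ) (p : ℂ[X]) :
    (conjReflect N p).coeff 0 = starRingEnd ℂ (p.coeff N) := by
  simp [conjReflect, coeff_reflect]

theorem natDegree_conjReflect_le {N : ℕ} {p : ℂ[X]} (hp : p.natDegree ≤ N) :
    (conjReflect N p).natDegree ≤ N := by
  refine natDegree_reflect_le.trans (max_le le_rfl ?_)
  exact natDegree_map_le.trans hp

theorem eval_conjReflect {N : ℕ} {p : ℂ[X]} (hp : p.natDegree ≤ N) {z : ℂ} (hz : z ≠ 0) :
    (conjReflect N p).eval z = z ^ N * starRingEnd ℂ (p.eval (starRingEnd ℂ z)⁻¹) := by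
  let _ : Invertible z⁻¹ := invertibleOfNonzero (inv_ne_zero hz)
  have h := eval₂_reflect_mul_pow (RingHom.id ℂ) z⁻¹ N (p.map (starRingEnd ℂ))
    (natDegree_map_le.trans hp)
  have h2 : eval₂ (RingHom.id ℂ) z⁻¹ (p.map (starRingEnd ℂ))
      = starRingEnd ℂ (p.eval (starRingEnd ℂ z)⁻¹) := by
    rw [← eval₂_at_apply, eval₂_map]
    simp
  rw [h2, invOf_eq_inv, inv_inv] at h
  rw [← h, conjReflect, eval, mul_comm, mul_assoc, ← mul_pow, inv_mul_cancel₀ hz, one_pow, mul_one]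

theorem ne_zero_of_norm_eq_one {z : ℂ} (hz : ‖z‖ = 1) : z ≠ 0 := by
  rintro rfl; simp at hz

theorem mul_conj_of_norm_eq_one {z : ℂ} (hz : ‖z‖ = 1) : z * starRingEnd ℂ z = 1 := by
  rw [Complex.mul_conj']; simp [hz]

/-- On the circle `1 / conj z = z`. Hence `p * conjReflect N p` takes the value `z ^ N |p z|²`
there, which turns statements about moduli into polynomial identities. -/
theorem eval_conjReflect_of_norm_eq_one {N : ℕ} {p : ℂ[X]} (hp : p.natDegree ≤ N) {z : ℂ}
    (hz : ‖z‖ = 1) : (conjReflect N p).eval z = z ^ N * starRingEnd ℂ (p.eval z) := by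
  rw [eval_conjReflect hp (ne_zero_of_norm_eq_one hz),
    inv_eq_of_mul_eq_one_left (mul_conj_of_norm_eq_one hz)]

theorem infinite_unit_circle : {z : ℂ | ‖z‖ = 1}.Infinite := by
  have h : Set.InjOn (fun x : ℝ => (Circle.exp x : ℂ)) (Set.Ioc (-Real.pi) Real.pi) := by
    intro x hx y hy hxy
    have := congrArg Complex.arg hxy
    simpa [Circle.arg_exp hx.1 hx.2, Circle.arg_exp hy.1 hy.2, -Circle.coe_exp] using this
  refine (((Set.Ioc_infinite (by linarith [Real.pi_pos])).image h)).mono ?_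
  rintro _ ⟨x, -, rfl⟩
  simp

theorem eq_of_eval_eq_on_circle {p q : ℂ[X]} (h : ∀ z : ℂ, ‖z‖ = 1 → p.eval z = q.eval z) :
    p = q :=
  eq_of_infinite_eval_eq p q (infinite_unit_circle.mono h)

/-- **Fejér–Riesz**: a trigonometric polynomial that is positive on the unit circle is the squared
modulus of a polynomial. -/
theorem fejer_riesz (n : ℕ) : ∀ p : ℂ[X], p.natDegree ≤ 2 * n →
    (∀ z : ℂ, ‖z‖ = 1 → ∃ r : ℝ, 0 < r ∧ p.eval z = r * z ^ n) →
    ∃ q : ℂ[X], q.natDegree ≤ n ∧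
      ∀ z : ℂ, ‖z‖ = 1 → p.eval z = ((‖q.eval z‖ ^ 2 : ℝ) : ℂ) * z ^ n := by
  induction n with
  | zero =>
    intro p hp h
    obtain ⟨c, rfl⟩ := natDegree_eq_zero.mp (by simpa using hp)
    obtain ⟨r, hr, hc⟩ := h 1 (by simp)
    refine ⟨C ((√r : ℝ) : ℂ), by simp, fun z _ => ?_⟩
    simp only [eval_C, pow_zero, mul_one] at hc ⊢
    rw [hc, Complex.norm_real, Real.norm_eq_abs, sq_abs, Real.sq_sqrt hr.le]
  | succ n ih =>
    intro p hp h
    -- Real values of `p z / z ^ (n + 1)` on the circle make `p` self-reciprocal. Its extreme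
    -- coefficients therefore vanish together, and its roots come in pairs `r`, `1 / conj r`.
    have hself : conjReflect (2 * (n + 1)) p = p := by
      refine eq_of_eval_eq_on_circle fun z hz => ?_
      obtain ⟨r, hr, e⟩ := h z hz
      rw [eval_conjReflect_of_norm_eq_one hp hz, e, map_mul, Complex.conj_ofReal, map_pow, two_mul,
        pow_add]
      have := congrArg (· ^ (n + 1)) (mul_conj_of_norm_eq_one hz)
      simp only [mul_pow, one_pow] at this
      linear_combination (r : ℂ) * z ^ (n + 1) * this
    -- If both extreme coefficients vanish, dividing by `X` lowers the degree bound by two and the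
    -- exponent of `z` by one.
    by_cases h0 : p.coeff 0 = 0
    · have htop : p.coeff (2 * (n + 1)) = 0 := by
        have := coeff_zero_conjReflect (2 * (n + 1)) p
        rw [hself, h0] at this
        simpa using this.symm
      obtain ⟨p', rfl⟩ := X_dvd_iff.mpr h0
      by_cases hp0 : p' = 0
      · obtain ⟨r, hr, e⟩ := h 1 (by simp)
        simp [hp0] at e
        exact absurd e.symm (by exact_mod_cast hr.ne')
      have hd : p'.natDegree ≤ 2 * n := by
        have h1 : (X * p').natDegree = p'.natDegree + 1 := by
          rw [natDegree_X_mul hp0]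
        by_contra hlt
        have h2 : p'.natDegree = 2 * n + 1 := by omega
        have : p'.leadingCoeff = 0 := by
          rw [leadingCoeff, h2, ← htop, show 2 * (n + 1) = (2 * n + 1) + 1 by ring, coeff_X_mul]
        exact hp0 (leadingCoeff_eq_zero.mp this)
      obtain ⟨q, hq, e⟩ := ih p' hd fun z hz => by
        obtain ⟨r, hr, e⟩ := h z hz
        refine ⟨r, hr, mul_left_cancel₀ (ne_zero_of_norm_eq_one hz) ?_⟩
        rw [eval_mul, eval_X] at e
        rw [e]; ring
      refine ⟨q, hq.trans n.le_succ, fun z hz => ?_⟩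
      rw [eval_mul, eval_X, e z hz]; ring
    · have htop : p.coeff (2 * (n + 1)) ≠ 0 := by
        intro h1
        have := coeff_zero_conjReflect (2 * (n + 1)) p
        rw [hself, h1] at this
        exact h0 (by simpa using this)
      have hdeg : p.natDegree = 2 * (n + 1) := le_antisymm hp (le_natDegree_of_ne_zero htop)
      have hpne : p ≠ 0 := by rintro rfl; simp at h0
      obtain ⟨r, hr⟩ := Complex.exists_root (f := p) (natDegree_pos_iff_degree_pos.mp (by omega))
      have hr0 : r ≠ 0 := by
        rintro rfl
        exact h0 (by rw [coeff_zero_eq_eval_zero]; exact hr)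
      have hcr0 : starRingEnd ℂ r ≠ 0 := by simpa using hr0
      have hr1 : ‖r‖ ≠ 1 := by
        intro h1
        obtain ⟨s, hs, e⟩ := h r h1
        rw [hr] at e
        exact mul_ne_zero (by exact_mod_cast hs.ne') (pow_ne_zero _ hr0) e.symm
      set r' : ℂ := (starRingEnd ℂ r)⁻¹ with hr'
      have hroot' : p.IsRoot r' := by
        have := eval_conjReflect hp hr0
        rw [hself, hr.eq_zero] at this
        rcases mul_eq_zero.mp this.symm with h1 | h1
        · exact absurd h1 (pow_ne_zero _ hr0)
        · simpa using h1
      -- Positivity keeps `r` off the circle, so its mirror image is a different root and both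
      -- linear factors can be split off at once.
      have hne : r ≠ r' := by
        intro h1
        apply hr1
        have h2 : r * starRingEnd ℂ r = 1 := by
          nth_rewrite 1 [h1]
          rw [hr', inv_mul_cancel₀ hcr0]
        rw [Complex.mul_conj'] at h2
        have h3 : ‖r‖ ^ 2 = 1 := by exact_mod_cast h2
        exact (pow_eq_one_iff_of_nonneg (norm_nonneg r) two_ne_zero).mp h3
      obtain ⟨p', hp'⟩ : (X - C r) * (X - C r') ∣ p :=
        (isCoprime_X_sub_C_of_isUnit_sub (sub_ne_zero.mpr hne).isUnit).mul_dvd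
          (dvd_iff_isRoot.mpr hr) (dvd_iff_isRoot.mpr hroot')
      have hp'0 : p' ≠ 0 := by rintro rfl; simp at hp'; exact hpne hp'
      have hd : p'.natDegree = 2 * n := by
        have h1 := congrArg natDegree hp'
        rw [natDegree_mul (mul_ne_zero (X_sub_C_ne_zero _) (X_sub_C_ne_zero _)) hp'0,
          natDegree_mul (X_sub_C_ne_zero _) (X_sub_C_ne_zero _), natDegree_X_sub_C,
          natDegree_X_sub_C, hdeg] at h1
        omega
      -- On the circle `(z - r)(z - r') = -r' z |z - r|²`. The pair of roots contributes a squared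
      -- modulus, and the constant `-r'` goes into the quotient.
      have key : ∀ z : ℂ, ‖z‖ = 1 → p.eval z
          = ((‖z - r‖ ^ 2 : ℝ) : ℂ) * z * (C (-r') * p').eval z := by
        intro z hz
        have h1 : starRingEnd ℂ r * r' = 1 := mul_inv_cancel₀ hcr0
        have h2 := mul_conj_of_norm_eq_one hz
        have h3 : ((‖z - r‖ ^ 2 : ℝ) : ℂ) = (z - r) * (starRingEnd ℂ z - starRingEnd ℂ r) := by
          rw [← map_sub, Complex.mul_conj']; simp
        rw [h3, hp']
        simp only [eval_mul, eval_sub, eval_X, eval_C]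
        linear_combination (-(z - r) * eval z p' * z) * h1 + (z - r) * eval z p' * r' * h2
      obtain ⟨q, hq, e⟩ := ih (C (-r') * p') ((natDegree_C_mul_le _ _).trans hd.le) fun z hz => by
        obtain ⟨s, hs, e⟩ := h z hz
        have hz0 := ne_zero_of_norm_eq_one hz
        have hzr : z - r ≠ 0 := by
          intro h1
          rw [sub_eq_zero] at h1
          exact hr1 (h1 ▸ hz)
        have hpos : 0 < ‖z - r‖ ^ 2 := by positivity
        have hposC : ((‖z - r‖ ^ 2 : ℝ) : ℂ) ≠ 0 := by exact_mod_cast hpos.ne'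
        refine ⟨s / ‖z - r‖ ^ 2, by positivity, ?_⟩
        apply mul_left_cancel₀ (mul_ne_zero hposC hz0)
        rw [← key z hz, e, Complex.ofReal_div]
        field_simp
        ring
      refine ⟨(X - C r) * q, ?_, fun z hz => ?_⟩
      · refine natDegree_mul_le.trans ?_
        rw [natDegree_X_sub_C]; omega
      · rw [key z hz, e z hz, eval_mul, norm_mul, mul_pow]
        simp only [eval_sub, eval_X, eval_C]
        push_cast
        ring

/-- A polynomial that is smaller than one on the unit circle has a complementary polynomial. -/
theorem exists_complementary {N : ℕ} {P : ℂ[X]} (hP : P.natDegree ≤ N)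
    (h : ∀ z : ℂ, ‖z‖ = 1 → ‖P.eval z‖ < 1) :
    ∃ Q : ℂ[X], Q.natDegree ≤ N ∧ ∀ z : ℂ, ‖z‖ = 1 → ‖P.eval z‖ ^ 2 + ‖Q.eval z‖ ^ 2 = 1 := by
  -- This polynomial represents `1 - |P|²`, to which Fejér–Riesz is applied.
  have hev : ∀ z : ℂ, ‖z‖ = 1 → (X ^ N - P * conjReflect N P).eval z
      = ((1 - ‖P.eval z‖ ^ 2 : ℝ) : ℂ) * z ^ N := by
    intro z hz
    have := Complex.mul_conj' (P.eval z)
    simp only [eval_sub, eval_pow, eval_X, eval_mul, eval_conjReflect_of_norm_eq_one hP hz]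
    push_cast
    linear_combination (-z ^ N) * this
  obtain ⟨Q, hQ, e⟩ := fejer_riesz N (X ^ N - P * conjReflect N P) (by
      refine (natDegree_sub_le _ _).trans (max_le (by simp; omega) ?_)
      refine natDegree_mul_le.trans ?_
      have := natDegree_conjReflect_le hP
      omega) (fun z hz => ⟨_, by nlinarith [h z hz, norm_nonneg (P.eval z)], hev z hz⟩)
  refine ⟨Q, hQ, fun z hz => ?_⟩
  have h1 := mul_right_cancel₀ (pow_ne_zero N (ne_zero_of_norm_eq_one hz))
    ((hev z hz).symm.trans (e z hz))
  have h2 : 1 - ‖P.eval z‖ ^ 2 = ‖Q.eval z‖ ^ 2 := by exact_mod_cast h1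
  linarith

/-! ### Quantum signal processing -/

/-- Products `R_N D R_{N-1} D ⋯ D R_0` of constant unitaries and `N` copies of `D = diag(X, 1)`. -/
inductive SignalProcessing : ℕ → Matrix (Fin 2) (Fin 2) ℂ[X] → Prop
  | const (R : Matrix.unitaryGroup (Fin 2) ℂ) :
      SignalProcessing 0 ((R : Matrix (Fin 2) (Fin 2) ℂ).map C)
  | step {N : ℕ} {M : Matrix (Fin 2) (Fin 2) ℂ[X]} (R : Matrix.unitaryGroup (Fin 2) ℂ) :
      SignalProcessing N M →
      SignalProcessing (N + 1)
        ((R : Matrix (Fin 2) (Fin 2) ℂ).map C * Matrix.diagonal ![X, 1] * M)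

/-- The unitary with first column `(a, b)`. -/
theorem exists_unitary_of_column {a b : ℂ} (h : ‖a‖ ^ 2 + ‖b‖ ^ 2 = 1) :
    ∃ R : Matrix.unitaryGroup (Fin 2) ℂ,
      (R : Matrix (Fin 2) (Fin 2) ℂ) = !![a, -starRingEnd ℂ b; b, starRingEnd ℂ a] := by
  refine ⟨⟨!![a, -starRingEnd ℂ b; b, starRingEnd ℂ a], ?_⟩, rfl⟩
  rw [Matrix.mem_unitaryGroup_iff']
  have ha := Complex.conj_mul' a
  have hb := Complex.conj_mul' b
  have h' : (‖a‖ : ℂ) ^ 2 + (‖b‖ : ℂ) ^ 2 = 1 := by exact_mod_cast h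
  ext i j
  fin_cases i <;> fin_cases j <;> simp [Matrix.mul_apply, Fin.sum_univ_two]
  · linear_combination ha + hb + h'
  · ring
  · ring
  · linear_combination ha + hb + h'

/-- Two orthogonal vectors of the plane are mapped to the coordinate axes by some unitary. -/
theorem exists_unitary_align {a b c d : ℂ} (h : a * starRingEnd ℂ c + b * starRingEnd ℂ d = 0) :
    ∃ u v : ℂ, ‖u‖ ^ 2 + ‖v‖ ^ 2 = 1 ∧ starRingEnd ℂ u * c + starRingEnd ℂ v * d = 0 ∧
      u * b - v * a = 0 := by
  have normalize : ∀ x y : ℂ, ¬ (x = 0 ∧ y = 0) → ∃ s : ℝ, 0 < s ∧ ‖x‖ ^ 2 + ‖y‖ ^ 2 = s ^ 2 := by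
    intro x y hxy
    have hpos : 0 < ‖x‖ ^ 2 + ‖y‖ ^ 2 := by
      by_cases hx : x = 0
      · have : y ≠ 0 := fun hy => hxy ⟨hx, hy⟩
        positivity
      · positivity
    exact ⟨√(‖x‖ ^ 2 + ‖y‖ ^ 2), Real.sqrt_pos.mpr hpos, (Real.sq_sqrt hpos.le).symm⟩
  have h' : starRingEnd ℂ a * c + starRingEnd ℂ b * d = 0 := by
    simpa using congrArg (starRingEnd ℂ) h
  -- The vector `(u, v)` has to be parallel to `(a, b)` and orthogonal to `(c, d)`: normalize `(a,
  -- b)`, or, if it vanishes, rotate `(c, d)` by a right angle.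
  by_cases hab : a = 0 ∧ b = 0
  · obtain ⟨rfl, rfl⟩ := hab
    by_cases hcd : c = 0 ∧ d = 0
    · obtain ⟨rfl, rfl⟩ := hcd
      exact ⟨1, 0, by simp, by simp, by simp⟩
    · obtain ⟨s, hs, e⟩ := normalize c d hcd
      refine ⟨-starRingEnd ℂ d / s, starRingEnd ℂ c / s, ?_, ?_, by simp⟩
      · rw [norm_div, norm_div, norm_neg, RCLike.norm_conj, RCLike.norm_conj, Complex.norm_real,
          Real.norm_of_nonneg hs.le]
        field_simp
        linarith
      · simp; ring
  · obtain ⟨s, hs, e⟩ := normalize a b hab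
    refine ⟨a / s, b / s, ?_, ?_, by ring⟩
    · rw [norm_div, norm_div, Complex.norm_real, Real.norm_of_nonneg hs.le]
      field_simp
      linarith
    · have hs' : (s : ℂ) ≠ 0 := by exact_mod_cast hs.ne'
      simp only [map_div₀, Complex.conj_ofReal]
      field_simp
      rw [h', mul_zero]

/-- A pair of polynomials with `|P|² + |Q|² = 1` on the unit circle is the first column of a
signal-processing product. -/
theorem exists_signalProcessing (N : ℕ) : ∀ P Q : ℂ[X], P.natDegree ≤ N → Q.natDegree ≤ N →
    (∀ z : ℂ, ‖z‖ = 1 → ‖P.eval z‖ ^ 2 + ‖Q.eval z‖ ^ 2 = 1) →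
    ∃ M, SignalProcessing N M ∧ M 0 0 = P ∧ M 1 0 = Q := by
  induction N with
  | zero =>
    intro P Q hP hQ h
    obtain ⟨a, rfl⟩ := natDegree_eq_zero.mp (Nat.le_zero.mp hP)
    obtain ⟨b, rfl⟩ := natDegree_eq_zero.mp (Nat.le_zero.mp hQ)
    obtain ⟨R, hR⟩ := exists_unitary_of_column (a := a) (b := b) (by simpa using h 1 (by simp))
    exact ⟨_, .const R, by simp [hR], by simp [hR]⟩
  | succ N ih =>
    intro P Q hP hQ h
    -- The normalization reads `P P~ + Q Q~ = X ^ (N + 1)`, where `~` is the conjugate reciprocal.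
    -- Its constant coefficient says that the lowest and highest coefficient vectors of `(P, Q)` are
    -- orthogonal.
    have horth : P.coeff 0 * starRingEnd ℂ (P.coeff (N + 1))
        + Q.coeff 0 * starRingEnd ℂ (Q.coeff (N + 1)) = 0 := by
      have : P * conjReflect (N + 1) P + Q * conjReflect (N + 1) Q = X ^ (N + 1) := by
        refine eq_of_eval_eq_on_circle fun z hz => ?_
        simp only [eval_add, eval_mul, eval_conjReflect_of_norm_eq_one hP hz,
          eval_conjReflect_of_norm_eq_one hQ hz, eval_pow, eval_X]
        have h1 := Complex.mul_conj' (P.eval z)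
        have h2 := Complex.mul_conj' (Q.eval z)
        have h3 : (‖P.eval z‖ : ℂ) ^ 2 + (‖Q.eval z‖ : ℂ) ^ 2 = 1 := by exact_mod_cast h z hz
        linear_combination z ^ (N + 1) * (h1 + h2 + h3)
      have := congrArg (fun p => coeff p 0) this
      simpa [mul_coeff_zero, coeff_zero_conjReflect] using this
    have horth' : P.coeff (N + 1) * starRingEnd ℂ (P.coeff 0)
        + Q.coeff (N + 1) * starRingEnd ℂ (Q.coeff 0) = 0 := by
      simpa [mul_comm] using congrArg (starRingEnd ℂ) horth
    -- The unitary `R*` kills the constant coefficient of the first component and the top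
    -- coefficient of the second. So `R* (P, Q) = (X P', Q')` with both degrees at most `N`, and one
    -- factor `R diag(X, 1)` is peeled off.
    obtain ⟨u, v, huv, h0, htop⟩ := exists_unitary_align horth'
    obtain ⟨R, hR⟩ := exists_unitary_of_column huv
    have hu := Complex.mul_conj' u
    have hv := Complex.mul_conj' v
    have huv' : (‖u‖ : ℂ) ^ 2 + (‖v‖ : ℂ) ^ 2 = 1 := by exact_mod_cast huv
    have huv'' : u * starRingEnd ℂ u + v * starRingEnd ℂ v = 1 := by rw [hu, hv, huv']
    obtain ⟨P', hP'⟩ : X ∣ C (starRingEnd ℂ u) * P + C (starRingEnd ℂ v) * Q := by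
      rw [X_dvd_iff]
      simpa using h0
    set Q' : ℂ[X] := C u * Q - C v * P with hQ'
    have hC : (C u : ℂ[X]) * C (starRingEnd ℂ u) + C v * C (starRingEnd ℂ v) = 1 := by
      rw [← C_mul, ← C_mul, ← C_add, huv'', C_1]
    have hPe : P = C u * (X * P') - C (starRingEnd ℂ v) * Q' := by
      rw [← hP', hQ']
      linear_combination (-P) * hC
    have hQe : Q = C v * (X * P') + C (starRingEnd ℂ u) * Q' := by
      rw [← hP', hQ']
      linear_combination (-Q) * hC
    have hdC : ∀ (a b : ℂ), (C a * P + C b * Q).natDegree ≤ N + 1 := fun a b =>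
      (natDegree_add_le _ _).trans (max_le ((natDegree_C_mul_le _ _).trans hP)
        ((natDegree_C_mul_le _ _).trans hQ))
    have hdP' : P'.natDegree ≤ N := by
      by_cases hz : P' = 0
      · simp [hz]
      · have := hdC (starRingEnd ℂ u) (starRingEnd ℂ v)
        rw [hP', natDegree_X_mul hz] at this
        omega
    have hdQ' : Q'.natDegree ≤ N := by
      have h1 : Q'.natDegree ≤ N + 1 := by
        have := hdC (-v) u
        rw [show C (-v) * P + C u * Q = Q' by rw [hQ', C_neg]; ring] at this
        exact this
      by_contra hlt
      have h2 : Q'.natDegree = N + 1 := by omega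
      have h3 : Q'.leadingCoeff = 0 := by
        rw [leadingCoeff, h2, hQ', coeff_sub, coeff_C_mul, coeff_C_mul, htop]
      rw [leadingCoeff_eq_zero] at h3
      rw [h3] at h2
      simp at h2
    obtain ⟨M, hM, hM0, hM1⟩ := ih P' Q' hdP' hdQ' fun z hz => by
      have key := h z hz
      have e1 : P.eval z = u * (z * P'.eval z) - starRingEnd ℂ v * Q'.eval z := by
        rw [hPe]; simp
      have e2 : Q.eval z = v * (z * P'.eval z) + starRingEnd ℂ u * Q'.eval z := by
        rw [hQe]; simp
      have hz1 := mul_conj_of_norm_eq_one hz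
      have : ((‖P.eval z‖ ^ 2 + ‖Q.eval z‖ ^ 2 : ℝ) : ℂ)
          = ((‖P'.eval z‖ ^ 2 + ‖Q'.eval z‖ ^ 2 : ℝ) : ℂ) := by
        push_cast
        simp only [← Complex.mul_conj']
        rw [e1, e2]
        simp only [map_sub, map_add, map_mul, Complex.conj_conj]
        linear_combination (z * starRingEnd ℂ z * P'.eval z * starRingEnd ℂ (P'.eval z)
          + Q'.eval z * starRingEnd ℂ (Q'.eval z)) * huv''
          + P'.eval z * starRingEnd ℂ (P'.eval z) * hz1
      rw [← key]
      exact_mod_cast this.symm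
    refine ⟨_, .step R hM, ?_, ?_⟩
    · rw [hPe]
      simp [Matrix.mul_apply, Fin.sum_univ_two, hR, hM0, hM1, Matrix.diagonal_apply]
      ring
    · rw [hQe]
      simp [Matrix.mul_apply, Fin.sum_univ_two, hR, hM0, hM1, Matrix.diagonal_apply]
      ring

end HamSim

namespace HamSim

open Matrix

variable {n b : ℕ}

/-! ### Oracle gates -/

section gates

variable {W : Type} (O : OracleData n b)

/-- The query that undoes a given query. -/
def Query.inv : Query → Query
  | .posn => .posnInv
  | .posnInv => .posn
  | .entry => .entry

theorem act_inv_act (q : Query) (x : Config n b W) : O.act q.inv (O.act q x) = x := by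
  obtain ⟨j, k, z, w⟩ := x
  cases q <;> simp [Query.inv, OracleData.act]

theorem act_act_inv (q : Query) (x : Config n b W) : O.act q (O.act q.inv x) = x := by
  obtain ⟨j, k, z, w⟩ := x
  cases q <;> simp [Query.inv, OracleData.act]

theorem eq_act_iff (q : Query) (x y : Config n b W) : x = O.act q y ↔ y = O.act q.inv x :=
  ⟨fun h => by rw [h, act_inv_act], fun h => by rw [h, act_act_inv]⟩

variable [DecidableEq W]

theorem conjTranspose_gate (q : Query) : (O.gate (W := W) q)ᴴ = O.gate q.inv := by
  ext x y
  simp only [OracleData.gate, conjTranspose_apply, of_apply, eq_act_iff O q y x]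
  split_ifs <;> simp

variable [Fintype W]

theorem gate_mul_apply {l : Type*} (q : Query) (N : Matrix (Config n b W) l ℂ)
    (x : Config n b W) (y : l) :
    (O.gate (W := W) q * N : Matrix (Config n b W) l ℂ) x y = N (O.act q.inv x) y := by
  simp [mul_apply, OracleData.gate, eq_act_iff O q x]

theorem mul_gate_apply {l : Type*} (q : Query) (N : Matrix l (Config n b W) ℂ)
    (x : l) (y : Config n b W) :
    (N * O.gate (W := W) q : Matrix l (Config n b W) ℂ) x y = N x (O.act q y) := by
  simp [mul_apply, OracleData.gate]

theorem gate_mul_gate_inv (q : Query) : O.gate (W := W) q * O.gate q.inv = 1 := by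
  ext x y
  rw [mul_gate_apply]
  simp only [OracleData.gate, of_apply, act_act_inv, one_apply]

theorem gate_mem_unitaryGroup (q : Query) : O.gate (W := W) q ∈ unitaryGroup (Config n b W) ℂ := by
  rw [mem_unitaryGroup_iff, star_eq_conjTranspose, conjTranspose_gate, gate_mul_gate_inv]

end gates

/-! ### Operators implemented by query algorithms -/

section implements

variable {W : Type} [Fintype W] [DecidableEq W]

/-- `Implements m F`: the oracle-dependent operator `F` is a product of oracle-independent unitaries
and `m` queries. -/
inductive Implements : ℕ → (OracleData n b → Matrix (Config n b W) (Config n b W) ℂ) → Prop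
  | unitary {U : Matrix (Config n b W) (Config n b W) ℂ} (hU : U ∈ unitaryGroup (Config n b W) ℂ) :
      Implements 0 fun _ => U
  | query {m : ℕ} {F : OracleData n b → Matrix (Config n b W) (Config n b W) ℂ} (q : Query)
      {U : Matrix (Config n b W) (Config n b W) ℂ} (hU : U ∈ unitaryGroup (Config n b W) ℂ)
      (h : Implements m F) : Implements (m + 1) fun O => U * O.gate q * F O

variable {m m' : ℕ} {F G : OracleData n b → Matrix (Config n b W) (Config n b W) ℂ}

theorem Implements.congr (h : Implements m F) (hm : m = m') (e : ∀ O, F O = G O) :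
    Implements m' G := by
  obtain rfl := hm
  obtain rfl : F = G := funext e
  exact h

theorem Implements.gate (q : Query) :
    Implements 1 fun O : OracleData n b => O.gate (W := W) q :=
  (Implements.query q (one_mem _) (.unitary (one_mem _))).congr rfl (by simp)

theorem Implements.unitary_mul {U : Matrix (Config n b W) (Config n b W) ℂ}
    (hU : U ∈ unitaryGroup (Config n b W) ℂ) (h : Implements m F) :
    Implements m fun O => U * F O := by
  cases h with
  | unitary hV => exact .unitary (mul_mem hU hV)
  | query q hV h => exact (Implements.query q (mul_mem hU hV) h).congr rfl (by simp [mul_assoc])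

theorem Implements.mul (hF : Implements m F) (hG : Implements m' G) :
    Implements (m + m') fun O => F O * G O := by
  induction hF with
  | unitary hU => exact (hG.unitary_mul hU).congr (by simp) (fun _ => rfl)
  | query q hU _ ih => exact (Implements.query q hU ih).congr (by ring) (by simp [mul_assoc])

theorem Implements.pow (hF : Implements m F) (k : ℕ) : Implements (m * k) fun O => F O ^ k := by
  induction k with
  | zero => exact (Implements.unitary (one_mem _)).congr (by simp) (by simp)
  | succ k ih => exact (ih.mul hF).congr (by ring) (by simp [pow_succ])

theorem Implements.mem_unitaryGroup (hF : Implements m F) (O : OracleData n b) :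
    F O ∈ unitaryGroup (Config n b W) ℂ := by
  induction hF with
  | unitary hU => exact hU
  | query q hU _ ih => exact mul_mem (mul_mem hU (gate_mem_unitaryGroup O q)) ih

theorem Implements.exists_queryAlgorithm (hF : Implements m F) :
    ∃ (U : unitaryGroup (Config n b W) ℂ) (s : List (Query × unitaryGroup (Config n b W) ℂ)),
      s.length = m ∧ ∀ (w₀ : W) (O : OracleData n b),
        (QueryAlgorithm.run { W := W, w₀ := w₀, first := U, steps := s } O) = F O := by
  induction hF with
  | unitary hU => exact ⟨⟨_, hU⟩, [], rfl, fun _ _ => rfl⟩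
  | query q hU _ ih =>
    obtain ⟨V, s, hs, e⟩ := ih
    refine ⟨V, s ++ [(q, ⟨_, hU⟩)], by simp [hs], fun w₀ O => ?_⟩
    simp only [← e w₀ O, QueryAlgorithm.run, List.foldl_append, List.foldl_cons, List.foldl_nil]

end implements

/-! ### Adjoining a control qubit -/

section control

variable {W : Type}

/-- A `2 × 2` matrix of operators as an operator with one more qubit in the workspace. -/
def adjoinQubit (M : Matrix (Fin 2) (Fin 2) (Matrix (Config n b W) (Config n b W) ℂ)) :
    Matrix (Config n b (W × Fin 2)) (Config n b (W × Fin 2)) ℂ :=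
  of fun x y => M x.2.2.2.2 y.2.2.2.2
    (x.1, x.2.1, x.2.2.1, x.2.2.2.1) (y.1, y.2.1, y.2.2.1, y.2.2.2.1)

variable (n b W) in
/-- Splitting off the control qubit. -/
def splitQubit : Config n b (W × Fin 2) ≃ Fin 2 × Config n b W where
  toFun x := (x.2.2.2.2, (x.1, x.2.1, x.2.2.1, x.2.2.2.1))
  invFun y := (y.2.1, y.2.2.1, y.2.2.2.1, (y.2.2.2.2, y.1))

theorem conjTranspose_adjoinQubit
    (M : Matrix (Fin 2) (Fin 2) (Matrix (Config n b W) (Config n b W) ℂ)) :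
    (adjoinQubit M)ᴴ = adjoinQubit Mᴴ := rfl

theorem adjoinQubit_one [DecidableEq W] :
    adjoinQubit (1 : Matrix (Fin 2) (Fin 2) (Matrix (Config n b W) (Config n b W) ℂ)) = 1 := by
  ext ⟨j, k, z, w, c⟩ ⟨j', k', z', w', c'⟩
  by_cases hc : c = c'
  · simp [adjoinQubit, hc, one_apply]
  · simp [adjoinQubit, hc, one_apply]

/-- `U` if the control qubit is `0`, and `V` if it is `1`. -/
def select (U V : Matrix (Config n b W) (Config n b W) ℂ) :
    Matrix (Config n b (W × Fin 2)) (Config n b (W × Fin 2)) ℂ :=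
  adjoinQubit (diagonal ![U, V])

theorem select_one [DecidableEq W] : select (1 : Matrix (Config n b W) (Config n b W) ℂ) 1 = 1 := by
  rw [select, ← adjoinQubit_one]
  congr 1
  rw [← diagonal_one]
  congr 1
  ext i : 1
  fin_cases i <;> rfl

/-- A query never touches the workspace, so the same query in both branches of the control costs one
query. Controlled queries are not available, and all controlled operators are built from this. -/
theorem select_gate [DecidableEq W] (O : OracleData n b) (q : Query) :
    select (O.gate (W := W) q) (O.gate q) = O.gate q := by
  ext ⟨j, k, z, w, c⟩ ⟨j', k', z', w', c'⟩
  by_cases hc : c = c'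
  · subst hc
    fin_cases c <;> cases q <;> simp [select, adjoinQubit, OracleData.gate, OracleData.act]
  · cases q <;> simp [select, adjoinQubit, hc, OracleData.gate, OracleData.act]

variable [Fintype W]

theorem adjoinQubit_mul (M N : Matrix (Fin 2) (Fin 2) (Matrix (Config n b W) (Config n b W) ℂ)) :
    adjoinQubit (M * N) = adjoinQubit M * adjoinQubit N := by
  ext x y
  simp only [adjoinQubit, of_apply, mul_apply, Matrix.sum_apply]
  rw [← Fintype.sum_prod_type']
  exact (Fintype.sum_equiv (splitQubit n b W) _ _ fun _ => rfl).symm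

theorem select_mul (U V U' V' : Matrix (Config n b W) (Config n b W) ℂ) :
    select U V * select U' V' = select (U * U') (V * V') := by
  rw [select, select, select, ← adjoinQubit_mul, diagonal_mul_diagonal]
  congr 2
  ext i : 1
  fin_cases i <;> rfl

variable [DecidableEq W]

theorem adjoinQubit_mem_unitaryGroup
    {M : Matrix (Fin 2) (Fin 2) (Matrix (Config n b W) (Config n b W) ℂ)} (hM : M * Mᴴ = 1) :
    adjoinQubit M ∈ unitaryGroup (Config n b (W × Fin 2)) ℂ := by
  rw [mem_unitaryGroup_iff, star_eq_conjTranspose, conjTranspose_adjoinQubit, ← adjoinQubit_mul, hM,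
    adjoinQubit_one]

theorem select_pow (U : Matrix (Config n b W) (Config n b W) ℂ) (k : ℕ) :
    select U U ^ k = select (U ^ k) (U ^ k) := by
  induction k with
  | zero => simp [select_one]
  | succ k ih => rw [pow_succ, ih, select_mul, ← pow_succ]

theorem select_mem_unitaryGroup {U V : Matrix (Config n b W) (Config n b W) ℂ}
    (hU : U ∈ unitaryGroup (Config n b W) ℂ) (hV : V ∈ unitaryGroup (Config n b W) ℂ) :
    select U V ∈ unitaryGroup (Config n b (W × Fin 2)) ℂ := by
  apply adjoinQubit_mem_unitaryGroup
  rw [mem_unitaryGroup_iff, star_eq_conjTranspose] at hU hV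
  rw [diagonal_conjTranspose, diagonal_mul_diagonal, ← diagonal_one]
  congr 1
  ext i : 1
  fin_cases i
  · exact hU
  · exact hV

theorem Implements.select_gate (q : Query) :
    Implements 1 fun O : OracleData n b => select (O.gate (W := W) q) (O.gate q) :=
  (Implements.gate q).congr rfl fun O => (HamSim.select_gate O q).symm

end control

end HamSim

namespace HamSim

open Matrix

variable {n b : ℕ}

/-! ### Block-diagonal unitaries -/

section blocks

variable {ι m o : Type*} [DecidableEq o]

/-- The operator that acts as `M k` on the factor `m` when the factor `o` has the value `k`. -/
def blockOp (e : ι ≃ m × o) (M : o → Matrix m m ℂ) : Matrix ι ι ℂ :=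
  (blockDiagonal M).submatrix e e

theorem blockOp_apply (e : ι ≃ m × o) (M : o → Matrix m m ℂ) (x y : ι) :
    blockOp e M x y = if (e x).2 = (e y).2 then M (e x).2 (e x).1 (e y).1 else 0 :=
  blockDiagonal_apply M (e x) (e y)

variable [Fintype m] [DecidableEq m] [Fintype o]

theorem blockOp_mem_unitaryGroup [Fintype ι] [DecidableEq ι] (e : ι ≃ m × o) {M : o → Matrix m m ℂ}
    (hM : ∀ k, M k ∈ unitaryGroup m ℂ) : blockOp e M ∈ unitaryGroup ι ℂ := by
  rw [mem_unitaryGroup_iff, star_eq_conjTranspose, blockOp, conjTranspose_submatrix,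
    submatrix_mul_equiv, blockDiagonal_conjTranspose, ← blockDiagonal_mul]
  have : (fun k => M k * (M k)ᴴ) = 1 := funext fun k => mem_unitaryGroup_iff.mp (hM k)
  rw [this, blockDiagonal_one, submatrix_one_equiv]

end blocks

theorem exists_unitary_of_unit_column {ι : Type*} [Fintype ι] [DecidableEq ι] (i₀ : ι) (u : ι → ℂ)
    (hu : ∑ i, ‖u i‖ ^ 2 = 1) : ∃ U ∈ unitaryGroup ι ℂ, ∀ i, U i i₀ = u i := by
  let v : ι → EuclideanSpace ℂ ι := fun _ => WithLp.toLp 2 u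
  have hv : Orthonormal ℂ (({i₀} : Set ι).domRestrict v) := by
    refine ⟨fun _ => ?_, fun i j hij => absurd (Subsingleton.elim i j) hij⟩
    change ‖(WithLp.toLp 2 u : EuclideanSpace ℂ ι)‖ = 1
    rw [EuclideanSpace.norm_eq]
    simp only [hu, Real.sqrt_one]
  obtain ⟨B, hB⟩ := hv.exists_orthonormalBasis_extension_of_card_eq (by simp)
  refine ⟨of fun i j => B j i, ?_, fun i => by simp [hB i₀ rfl, v]⟩
  rw [mem_unitaryGroup_iff', star_eq_conjTranspose]
  ext i j
  have h := orthonormal_iff_ite.mp B.orthonormal i j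
  rw [PiLp.inner_apply] at h
  simp only [mul_apply, conjTranspose_apply, of_apply, one_apply, ← h]
  exact Finset.sum_congr rfl fun k _ => by simp [mul_comm]

/-! ### The initial embedding -/

section embedding

variable {W : Type} [DecidableEq W]

variable (n b) in
/-- The isometry `|ψ⟩ ↦ |ψ⟩|0⟩|0⟩|w₀⟩`. -/
def inputEmbed (w₀ : W) : Matrix (Config n b W) (Label n) ℂ :=
  of fun x j => if x = (j, 0, fun _ => false, w₀) then 1 else 0

variable [Fintype W]

theorem mul_inputEmbed_apply {l : Type*} (w₀ : W) (N : Matrix l (Config n b W) ℂ) (x : l)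
    (j : Label n) :
    (N * inputEmbed n b w₀ : Matrix l (Label n) ℂ) x j = N x (j, 0, fun _ => false, w₀) := by
  simp [mul_apply, inputEmbed]

theorem conjTranspose_inputEmbed_mul_apply {l : Type*} (w₀ : W) (N : Matrix (Config n b W) l ℂ)
    (j : Label n) (y : l) :
    ((inputEmbed n b w₀)ᴴ * N : Matrix (Label n) l ℂ) j y = N (j, 0, fun _ => false, w₀) y := by
  simp [mul_apply, inputEmbed, apply_ite]

theorem conjTranspose_inputEmbed_mul_self (w₀ : W) :
    (inputEmbed n b w₀)ᴴ * inputEmbed n b w₀ = 1 := by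
  ext i j
  rw [conjTranspose_inputEmbed_mul_apply]
  simp [inputEmbed, one_apply]

/-- Starting and ending with the control in state `0` selects the corner block, which is where
signal processing puts its target polynomial. -/
theorem compress_adjoinQubit (w₀ : W)
    (M : Matrix (Fin 2) (Fin 2) (Matrix (Config n b W) (Config n b W) ℂ)) :
    (inputEmbed n b (w₀, (0 : Fin 2)))ᴴ * (adjoinQubit M * inputEmbed n b (w₀, (0 : Fin 2)))
      = (inputEmbed n b w₀)ᴴ * (M 0 0 * inputEmbed n b w₀) := by
  ext i j
  rw [conjTranspose_inputEmbed_mul_apply, conjTranspose_inputEmbed_mul_apply, mul_inputEmbed_apply,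
    mul_inputEmbed_apply]
  rfl

end embedding

/-! ### Oracle-independent parts of the walk -/

/-- The reflection with entry `a` in the upper left corner (the identity if `‖a‖ > 1`). -/
noncomputable def flag (a : ℂ) : Matrix (Fin 2) (Fin 2) ℂ :=
  -- The gate must be unitary for every content of the entry register, including strings that
  -- represent no entry of the matrix.
  if ‖a‖ ≤ 1 then
    !![a, (√(1 - ‖a‖ ^ 2) : ℝ); (√(1 - ‖a‖ ^ 2) : ℝ), -starRingEnd ℂ a]
  else 1

theorem flag_mem_unitaryGroup (a : ℂ) : flag a ∈ unitaryGroup (Fin 2) ℂ := by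
  unfold flag
  split_ifs with h
  · rw [mem_unitaryGroup_iff]
    have h1 := Complex.mul_conj' a
    have h2 : ((√(1 - ‖a‖ ^ 2) : ℝ) : ℂ) ^ 2 = 1 - (‖a‖ : ℂ) ^ 2 := by
      have := Real.sq_sqrt (show 0 ≤ 1 - ‖a‖ ^ 2 by nlinarith [norm_nonneg a])
      exact_mod_cast this
    ext i j
    fin_cases i <;> fin_cases j <;>
      simp [Matrix.mul_apply, Fin.sum_univ_two, -Complex.ofReal_sub, -Complex.ofReal_pow]
    · linear_combination h1 + h2
    · ring
    · ring
    · linear_combination h1 + h2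
  · exact one_mem _

theorem flag_conj {a : ℂ} : flag (starRingEnd ℂ a) = (flag a)ᴴ := by
  unfold flag
  rw [RCLike.norm_conj]
  split_ifs
  · ext i j
    fin_cases i <;> fin_cases j <;> simp
  · simp

variable (n b) in
/-- Swapping the two label registers. -/
def swapLabels : Config n b (Fin 2) ≃ Config n b (Fin 2) where
  toFun x := (x.2.1, x.1, x.2.2)
  invFun x := (x.2.1, x.1, x.2.2)

variable (n b) in
/-- The gate that swaps the two label registers. -/
def swapGate : Matrix (Config n b (Fin 2)) (Config n b (Fin 2)) ℂ :=
  (1 : Matrix (Config n b (Fin 2)) (Config n b (Fin 2)) ℂ).submatrix (swapLabels n b) id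

theorem swapGate_mul_apply {l : Type*} (N : Matrix (Config n b (Fin 2)) l ℂ)
    (x : Config n b (Fin 2)) (y : l) :
    (swapGate n b * N : Matrix (Config n b (Fin 2)) l ℂ) x y = N (swapLabels n b x) y := by
  simp [swapGate, mul_apply, one_apply]

theorem swapGate_mem_unitaryGroup :
    swapGate n b ∈ unitaryGroup (Config n b (Fin 2)) ℂ := by
  rw [mem_unitaryGroup_iff, star_eq_conjTranspose]
  ext x y
  rw [swapGate_mul_apply]
  simp [swapGate, one_apply, eq_comm]

/-- Singling out the second label register. -/
def secondRegister : Config n b (Fin 2) ≃ Label n × (Label n × Bits b × Fin 2) where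
  toFun x := (x.2.1, (x.1, x.2.2))
  invFun y := (y.2.1, y.1, y.2.2)

/-- Singling out the workspace qubit. -/
def flagRegister : Config n b (Fin 2) ≃ Fin 2 × (Label n × Label n × Bits b) where
  toFun x := (x.2.2.2, (x.1, x.2.1, x.2.2.1))
  invFun y := (y.2.1, y.2.2.1, y.2.2.2, y.1)

/-- Applying `U` to the second label register. -/
def prepareGate (U : Matrix (Label n) (Label n) ℂ) :
    Matrix (Config n b (Fin 2)) (Config n b (Fin 2)) ℂ :=
  blockOp secondRegister fun _ => U

/-- Applying `flag (α z)` to the workspace qubit, where `z` is the content of the entry register. -/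
noncomputable def flagGate (α : Bits b → ℂ) :
    Matrix (Config n b (Fin 2)) (Config n b (Fin 2)) ℂ :=
  blockOp flagRegister fun r => flag (α r.2.2)

theorem prepareGate_mem_unitaryGroup {U : Matrix (Label n) (Label n) ℂ}
    (hU : U ∈ unitaryGroup (Label n) ℂ) :
    prepareGate U ∈ unitaryGroup (Config n b (Fin 2)) ℂ :=
  blockOp_mem_unitaryGroup _ fun _ => hU

theorem flagGate_mem_unitaryGroup (α : Bits b → ℂ) :
    flagGate α ∈ unitaryGroup (Config n b (Fin 2)) ℂ :=
  blockOp_mem_unitaryGroup _ fun _ => flag_mem_unitaryGroup _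

/-- The reflection `2BB* - 1` about the range of `B`. -/
def reflection {ι κ : Type*} [Fintype κ] [DecidableEq ι] (B : Matrix ι κ ℂ) : Matrix ι ι ℂ :=
  (2 : ℂ) • (B * Bᴴ) - 1

theorem conjTranspose_reflection {ι κ : Type*} [Fintype κ] [DecidableEq ι] (B : Matrix ι κ ℂ) :
    (reflection B)ᴴ = reflection B := by
  simp [reflection]

section reflection

variable {ι κ : Type*} [Fintype ι] [DecidableEq ι] [Fintype κ] {B : Matrix ι κ ℂ}

/-- Reflecting about an oracle-dependent subspace amounts to conjugating a fixed reflection by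
queries. -/
theorem reflection_unitary_mul {V : Matrix ι ι ℂ} (hV : V * Vᴴ = 1) (B : Matrix ι κ ℂ) :
    reflection (V * B) = V * reflection B * Vᴴ := by
  simp only [reflection, conjTranspose_mul, Matrix.mul_sub, Matrix.sub_mul, Matrix.mul_smul,
    Matrix.smul_mul, Matrix.mul_one, hV, Matrix.mul_assoc]

variable [DecidableEq κ]

theorem reflection_mul (hB : Bᴴ * B = 1) : reflection B * B = B := by
  rw [reflection, Matrix.sub_mul, Matrix.one_mul, Matrix.smul_mul, Matrix.mul_assoc, hB,
    Matrix.mul_one, two_smul, add_sub_cancel_right]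

theorem reflection_mul_self (hB : Bᴴ * B = 1) : reflection B * reflection B = 1 := by
  conv_lhs => rhs; rw [reflection]
  rw [Matrix.mul_sub, Matrix.mul_smul, ← Matrix.mul_assoc, reflection_mul hB, Matrix.mul_one,
    reflection, sub_sub_cancel]

theorem reflection_mem_unitaryGroup (hB : Bᴴ * B = 1) : reflection B ∈ unitaryGroup ι ℂ := by
  rw [mem_unitaryGroup_iff, star_eq_conjTranspose, conjTranspose_reflection, reflection_mul_self hB]

end reflection

/-! ### The quantum walk -/

section walk

variable (U : Matrix (Label n) (Label n) ℂ) (α : Bits b → ℂ) (O : OracleData n b)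

variable (b) in
/-- The oracle-independent part of the state preparation. -/
def prepareEmbed : Matrix (Config n b (Fin 2)) (Label n) ℂ :=
  prepareGate (b := b) U * inputEmbed n b (0 : Fin 2)

/-- The isometry that maps `|j⟩` to a superposition of `|j, k⟩` over the neighbours `k` of `j`. -/
def neighbours : Matrix (Config n b (Fin 2)) (Label n) ℂ :=
  O.gate (W := Fin 2) .posn * prepareEmbed b U

/-- The flip `|j, k⟩ ↦ |k, j⟩`, with the matrix entry as an amplitude of the workspace qubit. -/
noncomputable def flip : Matrix (Config n b (Fin 2)) (Config n b (Fin 2)) ℂ :=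
  swapGate n b * (O.gate .entry * (flagGate α * O.gate .entry))

/-- The step of the quantum walk. -/
noncomputable def walk : Matrix (Config n b (Fin 2)) (Config n b (Fin 2)) ℂ :=
  flip α O * reflection (neighbours U O)

variable {U}

theorem prepareEmbed_isometry (hU : U ∈ unitaryGroup (Label n) ℂ) :
    (prepareEmbed b U : Matrix (Config n b (Fin 2)) (Label n) ℂ)ᴴ * prepareEmbed b U = 1 := by
  have := mem_unitaryGroup_iff'.mp (prepareGate_mem_unitaryGroup (b := b) hU)
  rw [star_eq_conjTranspose] at this
  rw [prepareEmbed, conjTranspose_mul, Matrix.mul_assoc, ← Matrix.mul_assoc _ (prepareGate U), this,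
    Matrix.one_mul, conjTranspose_inputEmbed_mul_self]

theorem neighbours_isometry (hU : U ∈ unitaryGroup (Label n) ℂ) :
    (neighbours U O)ᴴ * neighbours U O = 1 := by
  have := mem_unitaryGroup_iff'.mp (gate_mem_unitaryGroup (W := Fin 2) O .posn)
  rw [star_eq_conjTranspose] at this
  rw [neighbours, conjTranspose_mul, Matrix.mul_assoc, ← Matrix.mul_assoc _ (O.gate .posn), this,
    Matrix.one_mul, prepareEmbed_isometry hU]

theorem reflection_neighbours :
    reflection (neighbours U O) =
      O.gate .posn * reflection (prepareEmbed b U) * O.gate .posnInv := by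
  have := mem_unitaryGroup_iff.mp (gate_mem_unitaryGroup (W := Fin 2) O .posn)
  rw [star_eq_conjTranspose] at this
  rw [neighbours, reflection_unitary_mul this, conjTranspose_gate]
  rfl

theorem entry_mul_entry : O.gate (W := Fin 2) .entry * O.gate .entry = 1 :=
  gate_mul_gate_inv O .entry

theorem posn_mul_posnInv : O.gate (W := Fin 2) .posn * O.gate .posnInv = 1 :=
  gate_mul_gate_inv O .posn

/-- Only the oracle-independent gates are controlled. The four queries run in both branches, and in
the idle branch they cancel in pairs: `entry` with `entry`, `posn` with `posnInv`. -/
theorem implements_select_walk (hU : U ∈ unitaryGroup (Label n) ℂ) :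
    Implements 4 fun O : OracleData n b => select (walk U α O) 1 := by
  have hr := reflection_mem_unitaryGroup (prepareEmbed_isometry (b := b) hU)
  have h1 := Implements.unitary (select_mem_unitaryGroup (swapGate_mem_unitaryGroup (n := n) (b := b))
    (one_mem _))
  have h2 := Implements.unitary (select_mem_unitaryGroup (flagGate_mem_unitaryGroup (n := n) α)
    (one_mem _))
  have h3 := Implements.unitary (select_mem_unitaryGroup hr (one_mem _))
  have hq := fun q => Implements.select_gate (n := n) (b := b) (W := Fin 2) q
  refine (((((h1.mul (hq .entry)).mul h2).mul (hq .entry)).mul (hq .posn)).mul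
    (h3.mul (hq .posnInv))).congr rfl fun O => ?_
  simp only [select_mul, walk, flip, reflection_neighbours]
  congr 1
  · simp only [Matrix.mul_assoc]
  · simp only [Matrix.one_mul, Matrix.mul_one, entry_mul_entry, posn_mul_posnInv]

theorem implements_select_walk_conjTranspose (hU : U ∈ unitaryGroup (Label n) ℂ) :
    Implements 4 fun O : OracleData n b => select (walk U α O)ᴴ (walk U α O)ᴴ := by
  have hr := reflection_mem_unitaryGroup (prepareEmbed_isometry (b := b) hU)
  have hs := Unitary.star_mem (swapGate_mem_unitaryGroup (n := n) (b := b))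
  have hf := Unitary.star_mem (flagGate_mem_unitaryGroup (n := n) α)
  have h1 := Implements.unitary (select_mem_unitaryGroup hs hs)
  have h2 := Implements.unitary (select_mem_unitaryGroup hf hf)
  have h3 := Implements.unitary (select_mem_unitaryGroup hr hr)
  have hq := fun q => Implements.select_gate (n := n) (b := b) (W := Fin 2) q
  refine (((hq .posn).mul h3).mul ((hq .posnInv).mul ((hq .entry).mul (h2.mul
    ((hq .entry).mul h1))))).congr rfl fun O => ?_
  have he : (O.gate (W := Fin 2) .entry)ᴴ = O.gate .entry := conjTranspose_gate O .entry
  have : (walk U α O)ᴴ = O.gate .posn * reflection (prepareEmbed b U) * (O.gate .posnInv *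
      (O.gate .entry * ((flagGate α)ᴴ * (O.gate .entry * (swapGate n b)ᴴ)))) := by
    rw [walk, conjTranspose_mul, conjTranspose_reflection, reflection_neighbours]
    simp only [flip, conjTranspose_mul, he, Matrix.mul_assoc]
  simp only [select_mul, this]
  rfl

theorem walk_mem_unitaryGroup (hU : U ∈ unitaryGroup (Label n) ℂ) :
    walk U α O ∈ unitaryGroup (Config n b (Fin 2)) ℂ :=
  mul_mem (mul_mem swapGate_mem_unitaryGroup (mul_mem (gate_mem_unitaryGroup O _)
    (mul_mem (flagGate_mem_unitaryGroup α) (gate_mem_unitaryGroup O _))))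
    (reflection_mem_unitaryGroup (neighbours_isometry O hU))

theorem neighbours_apply (x : Config n b (Fin 2)) (j : Label n) :
    neighbours U O x j =
      if x.1 = j ∧ x.2.2 = (fun _ => false, 0) then U ((O.f j).symm x.2.1) 0 else 0 := by
  rw [neighbours, gate_mul_apply, prepareEmbed, mul_inputEmbed_apply, prepareGate, blockOp_apply]
  obtain ⟨i, k, z, w⟩ := x
  simp only [secondRegister, Equiv.coe_fn_mk, Query.inv, OracleData.act, Prod.mk.injEq]
  by_cases h : i = j
  · subst h; rfl
  · simp [h]

theorem flip_apply (x y : Config n b (Fin 2)) :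
    flip α O x y = flagGate α (O.act .entry (swapLabels n b x)) (O.act .entry y) := by
  rw [flip, swapGate_mul_apply, gate_mul_apply, mul_gate_apply]
  rfl

variable {α O}

/-- The flag gate changes neither the labels nor the entry register, so the second `entry` query
erases what the first one wrote. -/
theorem flip_apply_of_entry_zero {y : Config n b (Fin 2)} (hy : y.2.2.1 = fun _ => false)
    (x : Config n b (Fin 2)) :
    flip α O x y = if x.1 = y.2.1 ∧ x.2.1 = y.1 ∧ x.2.2.1 = fun _ => false then
      flag (α (O.h y.1 y.2.1)) x.2.2.2 y.2.2.2 else 0 := by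
  obtain ⟨j, k, z, a⟩ := x
  obtain ⟨j', k', z', a'⟩ := y
  obtain rfl : z' = fun _ => false := hy
  rw [flip_apply, flagGate, blockOp_apply]
  simp only [flagRegister, Equiv.coe_fn_mk, OracleData.act, swapLabels, Prod.mk.injEq,
    Bool.false_xor]
  by_cases h : k = j' ∧ j = k'
  · obtain ⟨rfl, rfl⟩ := h
    have : (fun i => (z i ^^ O.h k j i)) = O.h k j ↔ z = fun _ => false := by
      simp only [funext_iff]
      exact forall_congr' fun i => by cases z i <;> simp
    simp only [true_and, this]
    split_ifs with hz
    · simp [hz]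
    · rfl
  · rw [if_neg (fun h' => h ⟨h'.1, h'.2.1⟩), if_neg (fun h' => h ⟨h'.2.1, h'.1⟩)]

/-- Reversing `|j, k⟩ ↦ |k, j⟩` conjugates the entry, and `flag` turns conjugation into the adjoint.
The restriction to an empty entry register matters: the strings `z ⊕ h j k` and `z ⊕ h k j` need not
have conjugate values under `α`. -/
theorem star_flip_apply_of_entry_zero
    (hα : ∀ j k, α (O.h k j) = starRingEnd ℂ (α (O.h j k)))
    {y : Config n b (Fin 2)} (hy : y.2.2.1 = fun _ => false) (x : Config n b (Fin 2)) :
    star (flip α O y x) = flip α O x y := by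
  by_cases hx : x.2.2.1 = fun _ => false
  · rw [flip_apply_of_entry_zero hx, flip_apply_of_entry_zero hy]
    by_cases h : x.1 = y.2.1 ∧ x.2.1 = y.1
    · rw [if_pos ⟨h.2.symm, h.1.symm, hy⟩, if_pos ⟨h.1, h.2, hx⟩, h.1, h.2, hα, flag_conj]
      simp
    · rw [if_neg (fun h' => h ⟨h'.2.1.symm, h'.1.symm⟩), if_neg (fun h' => h ⟨h'.1, h'.2.1⟩),
        star_zero]
  · rw [flip_apply_of_entry_zero hy, if_neg (fun h => hx h.2.2), flip_apply, flagGate,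
      blockOp_apply, if_neg, star_zero]
    obtain ⟨j, k, z, a⟩ := x
    obtain ⟨j', k', z', a'⟩ := y
    obtain rfl : z' = fun _ => false := hy
    simp only [flagRegister, Equiv.coe_fn_mk, OracleData.act, swapLabels, Prod.mk.injEq,
      Bool.false_xor]
    rintro ⟨rfl, rfl, h⟩
    apply hx
    funext i
    have := congrFun h i
    cases hz : z i
    · exact hz
    · simp [hz] at this

theorem conjTranspose_flip_mul_neighbours
    (hα : ∀ j k, α (O.h k j) = starRingEnd ℂ (α (O.h j k))) :
    (flip α O)ᴴ * neighbours U O = flip α O * neighbours U O := by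
  ext x j
  simp only [mul_apply, conjTranspose_apply]
  refine Finset.sum_congr rfl fun y _ => ?_
  by_cases hy : y.2.2.1 = fun _ => false
  · rw [star_flip_apply_of_entry_zero hα hy]
  · rw [neighbours_apply, if_neg, mul_zero, mul_zero]
    rintro ⟨-, h⟩
    exact hy (by rw [h])

/-- The operator encoded by the walk. -/
theorem compress_flip (hα : ∀ j k, ‖α (O.h j k)‖ ≤ 1) (i j : Label n) :
    ((neighbours U O)ᴴ * (flip α O * neighbours U O)) i j =
      star (U ((O.f i).symm j) 0) * U ((O.f j).symm i) 0 * α (O.h j i) := by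
  have h1 : ∀ x : Config n b (Fin 2), (flip α O * neighbours U O) x j
      = if x.2.1 = j ∧ x.2.2.1 = fun _ => false then
        flag (α (O.h j x.1)) x.2.2.2 0 * U ((O.f j).symm x.1) 0 else 0 := by
    intro x
    rw [mul_apply, Finset.sum_eq_single (j, x.1, (fun _ => false), 0)]
    · rw [flip_apply_of_entry_zero rfl, neighbours_apply]
      by_cases h : x.2.1 = j ∧ x.2.2.1 = fun _ => false
      · simp [h]
      · simp [h]
    · intro y _ hy
      rw [neighbours_apply]
      split_ifs with h
      · rw [flip_apply_of_entry_zero (by rw [h.2]), if_neg, zero_mul]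
        rintro ⟨h2, -, -⟩
        exact hy (Prod.ext h.1 (Prod.ext h2.symm h.2))
      · rw [mul_zero]
    · simp
  rw [mul_apply, Finset.sum_eq_single (i, j, (fun _ => false), 0)]
  · rw [h1, conjTranspose_apply, neighbours_apply]
    simp [flag, hα]
    ring
  · intro x _ hx
    rw [h1, conjTranspose_apply, neighbours_apply]
    split_ifs with h h'
    · exact absurd (Prod.ext h.1 (Prod.ext h'.1 h.2)) hx
    all_goals simp
  · simp

/-- On the range of the isometry, the real part of the walk is the encoded operator. -/
theorem walk_add_conjTranspose_mul_neighbours (hU : U ∈ unitaryGroup (Label n) ℂ)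
    (hα : ∀ j k, α (O.h k j) = starRingEnd ℂ (α (O.h j k))) :
    (walk U α O + (walk U α O)ᴴ) * neighbours U O = neighbours U O *
      ((2 : ℂ) • ((neighbours U O)ᴴ * (flip α O * neighbours U O))) := by
  have hT := neighbours_isometry O hU
  rw [walk, conjTranspose_mul, conjTranspose_reflection, Matrix.add_mul, Matrix.mul_assoc,
    reflection_mul hT, Matrix.mul_assoc, conjTranspose_flip_mul_neighbours hα]
  -- With `R = 2TT* - 1` the left side is now `S T + R S T`. Expanding `R` leaves `2 T (T* S T)`.
  conv_lhs => rhs; rw [reflection]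
  rw [Matrix.sub_mul, Matrix.one_mul, Matrix.smul_mul, Matrix.mul_smul, Matrix.mul_assoc]
  abel

end walk

end HamSim

namespace HamSim

open Matrix Polynomial

variable {n b : ℕ}

/-! ### Truncated exponential series -/

/-- For `k ≥ m` the factor `exp (k - m)` is at least one. Inserting it into the tail gives a series
bounded by `exp (-m) ∑ (eτ) ^ k / k!`. -/
theorem norm_exp_sub_sum_le {𝔸 : Type*} [NormedRing 𝔸] [NormedAlgebra ℂ 𝔸] [CompleteSpace 𝔸]
    [NormOneClass 𝔸] {a : 𝔸} {τ : ℝ} (ha : ‖a‖ ≤ τ) (m : ℕ) :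
    ‖NormedSpace.exp a - ∑ k ∈ Finset.range m, ((k.factorial : ℂ))⁻¹ • a ^ k‖
      ≤ Real.exp (Real.exp 1 * τ - m) := by
  have h1 : HasSum (fun k : ℕ => ((k.factorial : ℂ))⁻¹ • a ^ k) (NormedSpace.exp a) :=
    NormedSpace.exp_series_hasSum_exp' a
  have h2 : HasSum (fun k : ℕ => if k ∈ Finset.range m then ((k.factorial : ℂ))⁻¹ • a ^ k else 0)
      (∑ k ∈ Finset.range m, ((k.factorial : ℂ))⁻¹ • a ^ k) := by
    have := hasSum_sum_of_ne_finset_zero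
      (f := fun k : ℕ => if k ∈ Finset.range m then ((k.factorial : ℂ))⁻¹ • a ^ k else 0)
      (s := Finset.range m) (L := SummationFilter.unconditional ℕ) (fun k hk => if_neg hk)
    rwa [Finset.sum_congr rfl fun k hk => if_pos hk] at this
  have h3 : HasSum (fun k : ℕ => Real.exp (-m) * ((Real.exp 1 * τ) ^ k / k.factorial))
      (Real.exp (-m) * Real.exp (Real.exp 1 * τ)) := by
    have := NormedSpace.expSeries_div_hasSum_exp (Real.exp 1 * τ)
    rw [← Real.exp_eq_exp_ℝ] at this
    exact this.mul_left _
  rw [sub_eq_neg_add (Real.exp 1 * τ), Real.exp_add]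
  refine (h1.sub h2).norm_le_of_bounded h3 fun k => ?_
  have hτ : 0 ≤ τ := (norm_nonneg a).trans ha
  split_ifs with hk
  · rw [sub_self, norm_zero]; positivity
  · have hmk : (m : ℝ) ≤ k := by exact_mod_cast not_lt.mp (fun h => hk (Finset.mem_range.mpr h))
    rw [sub_zero, norm_smul, norm_inv, Complex.norm_natCast, mul_pow, ← Real.exp_nat_mul, mul_one,
      ← mul_div_assoc, ← mul_assoc, ← Real.exp_add, inv_mul_eq_div]
    gcongr
    calc ‖a ^ k‖ ≤ ‖a‖ ^ k := norm_pow_le a k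
      _ ≤ τ ^ k := by gcongr
      _ = 1 * τ ^ k := (one_mul _).symm
      _ ≤ Real.exp (-m + k) * τ ^ k := by
        gcongr
        exact Real.one_le_exp (by linarith)

/-- `z ^ K` times the Taylor polynomial of degree `K` of `exp (-iτ(z + 1/z)/2)`. -/
noncomputable def cosineExp (τ : ℝ) (K : ℕ) : ℂ[X] :=
  ∑ k ∈ Finset.range (K + 1),
    C ((k.factorial : ℂ)⁻¹ * (-(Complex.I * τ) / 2) ^ k) * (X ^ (K - k) * (X ^ 2 + 1) ^ k)

theorem natDegree_cosineExp_le (τ : ℝ) (K : ℕ) : (cosineExp τ K).natDegree ≤ 2 * K := by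
  refine natDegree_sum_le_of_forall_le _ _ fun k hk => (natDegree_C_mul_le _ _).trans ?_
  have hk : k ≤ K := Nat.lt_succ_iff.mp (Finset.mem_range.mp hk)
  have h2 : (X ^ 2 + 1 : ℂ[X]).natDegree ≤ 2 := by
    refine (natDegree_add_le _ _).trans (by simp)
  calc (X ^ (K - k) * (X ^ 2 + 1) ^ k : ℂ[X]).natDegree
      ≤ (K - k) + k * 2 := by
        refine natDegree_mul_le.trans (add_le_add (by simp) (natDegree_pow_le.trans ?_))
        gcongr
    _ ≤ 2 * K := by omega

/-- Only a pair of mutual inverses is needed, so this serves both for a point of the circle with its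
conjugate and for the walk with its adjoint. -/
theorem pow_mul_aeval_cosineExp {𝔸 : Type*} [Ring 𝔸] [Algebra ℂ 𝔸] {w w' : 𝔸} (h : w * w' = 1)
    (h' : w' * w = 1) (τ : ℝ) (K : ℕ) :
    w' ^ K * aeval w (cosineExp τ K) = ∑ k ∈ Finset.range (K + 1),
      (k.factorial : ℂ)⁻¹ • ((-(Complex.I * τ) / 2) • (w + w')) ^ k := by
  rw [cosineExp, map_sum, Finset.mul_sum]
  refine Finset.sum_congr rfl fun k hk => ?_
  have hk : k ≤ K := Nat.lt_succ_iff.mp (Finset.mem_range.mp hk)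
  have hc : Commute w' w := h'.trans h.symm
  have h1 : w' ^ K * w ^ (K - k) = w' ^ k := by
    conv_lhs => rw [← Nat.add_sub_cancel' hk]
    rw [pow_add, add_tsub_cancel_left, mul_assoc, ← hc.mul_pow, h', one_pow, mul_one]
  have h2 : w' * (w ^ 2 + 1) = w + w' := by
    rw [mul_add, mul_one, sq, ← mul_assoc, h', one_mul]
  have h3 : Commute w' (w ^ 2 + 1) := (hc.pow_right 2).add_right (Commute.one_right w')
  rw [map_mul, aeval_C, ← Algebra.smul_def]
  simp only [map_mul, map_pow, map_add, map_one, aeval_X]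
  rw [mul_smul_comm, ← mul_assoc, h1, ← h3.mul_pow, h2, mul_smul, _root_.smul_pow]

/-- Up to a unimodular factor, the value is a Taylor polynomial of `exp (-iτ Re z)`, which has
modulus one. -/
theorem norm_eval_cosineExp_le {τ : ℝ} (hτ : 0 ≤ τ) (K : ℕ) {z : ℂ} (hz : ‖z‖ = 1) :
    ‖(cosineExp τ K).eval z‖ ≤ 1 + Real.exp (Real.exp 1 * τ - (K + 1 : ℕ)) := by
  have hzz := mul_conj_of_norm_eq_one hz
  have h1 := pow_mul_aeval_cosineExp hzz ((mul_comm _ _).trans hzz) τ K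
  have h2 : (-(Complex.I * τ) / 2) • (z + starRingEnd ℂ z) = ((-(τ * z.re) : ℝ) : ℂ) * Complex.I := by
    rw [Complex.add_conj, smul_eq_mul]; push_cast; ring
  have h3 : ‖(-(Complex.I * τ) / 2) • (z + starRingEnd ℂ z)‖ ≤ τ := by
    rw [h2, norm_mul, Complex.norm_I, mul_one, Complex.norm_real, norm_neg, norm_mul,
      Real.norm_of_nonneg hτ, Real.norm_eq_abs]
    exact mul_le_of_le_one_right hτ ((Complex.abs_re_le_norm z).trans hz.le)
  have h4 := norm_exp_sub_sum_le h3 (K + 1)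
  rw [← h1, ← Complex.exp_eq_exp_ℂ, h2] at h4
  have h5 : ‖(cosineExp τ K).eval z‖ = ‖starRingEnd ℂ z ^ K * aeval z (cosineExp τ K)‖ := by
    rw [norm_mul, norm_pow, RCLike.norm_conj, hz, one_pow, one_mul, coe_aeval_eq_eval]
  have h6 := Complex.norm_exp_ofReal_mul_I (-(τ * z.re))
  rw [h5]
  calc _ ≤ _ := norm_le_norm_add_norm_sub (Complex.exp (((-(τ * z.re) : ℝ) : ℂ) * Complex.I)) _
    _ ≤ _ := by rw [h6]; gcongr

/-- Quantum signal processing reaches the (slightly damped) polynomial `cosineExp`. -/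
theorem exists_signalProcessing_cosineExp {τ δ : ℝ} (hτ : 0 ≤ τ) (hδ : 0 < δ) {K : ℕ}
    (hK : Real.exp (Real.exp 1 * τ - (K + 1 : ℕ)) ≤ δ) :
    ∃ M, SignalProcessing (2 * K) M ∧
      M 0 0 = C (((1 + 2 * δ)⁻¹ : ℝ) : ℂ) * cosineExp τ K := by
  have hP : (C (((1 + 2 * δ)⁻¹ : ℝ) : ℂ) * cosineExp τ K).natDegree ≤ 2 * K :=
    (natDegree_C_mul_le _ _).trans (natDegree_cosineExp_le τ K)
  -- The modulus is at most `1 + δ`. Dividing by `1 + 2δ` makes it strictly less than one, as the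
  -- complementary polynomial requires.
  obtain ⟨Q, hQ, hPQ⟩ := exists_complementary hP fun z hz => by
    have h1 := (norm_eval_cosineExp_le hτ K hz).trans (add_le_add_right hK 1)
    have h2 : 0 < 1 + 2 * δ := by positivity
    rw [eval_mul, eval_C, norm_mul, Complex.norm_real, norm_inv, Real.norm_of_nonneg h2.le,
      inv_mul_lt_one₀ h2]
    linarith
  obtain ⟨M, hM, h0, -⟩ := exists_signalProcessing (2 * K) _ Q hP hQ hPQ
  exact ⟨M, hM, h0⟩

/-! ### The simulation circuit -/

section circuit

variable {U : Matrix (Label n) (Label n) ℂ}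

theorem implements_signalProcessing (hU : U ∈ unitaryGroup (Label n) ℂ) (α : Bits b → ℂ) {N : ℕ}
    {M : Matrix (Fin 2) (Fin 2) ℂ[X]} (hM : SignalProcessing N M) :
    Implements (4 * N) fun O : OracleData n b => adjoinQubit (M.map (aeval (walk U α O))) := by
  have hconst : ∀ R : unitaryGroup (Fin 2) ℂ,
      adjoinQubit ((R : Matrix (Fin 2) (Fin 2) ℂ).map
        (algebraMap ℂ (Matrix (Config n b (Fin 2)) (Config n b (Fin 2)) ℂ))) ∈
        unitaryGroup (Config n b (Fin 2 × Fin 2)) ℂ := by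
    intro R
    apply adjoinQubit_mem_unitaryGroup
    have h1 := mem_unitaryGroup_iff.mp R.2
    rw [star_eq_conjTranspose] at h1
    rw [← conjTranspose_map _ (fun c => algebraMap_star_comm c), ← Matrix.map_mul, h1]
    exact Matrix.map_one _ (map_zero _) (map_one _)
  have hmap : ∀ (R : unitaryGroup (Fin 2) ℂ) (O : OracleData n b),
      ((R : Matrix (Fin 2) (Fin 2) ℂ).map C).map (aeval (walk U α O)) =
        (R : Matrix (Fin 2) (Fin 2) ℂ).map
          (algebraMap ℂ (Matrix (Config n b (Fin 2)) (Config n b (Fin 2)) ℂ)) := by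
    intro R O
    ext i j : 2
    simp
  induction hM with
  | const R => exact (Implements.unitary (hconst R)).congr (by simp) fun O => by rw [hmap]
  | step R hM ih =>
    refine (((Implements.unitary (hconst R)).mul (implements_select_walk α hU)).mul ih).congr
      (by ring) fun O => ?_
    rw [select, ← adjoinQubit_mul, ← adjoinQubit_mul, Matrix.map_mul, Matrix.map_mul, hmap]
    congr 3
    rw [diagonal_map (map_zero _)]
    congr 1
    ext i : 1
    fin_cases i <;> simp

/-- The circuit: prepare, run the signal processing, undo the degree shift, and unprepare. -/
theorem exists_implements_compress (hU : U ∈ unitaryGroup (Label n) ℂ) (α : Bits b → ℂ) {N : ℕ}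
    {M : Matrix (Fin 2) (Fin 2) ℂ[X]} (hM : SignalProcessing N M) (K : ℕ) :
    ∃ F : OracleData n b → Matrix (Config n b (Fin 2 × Fin 2)) (Config n b (Fin 2 × Fin 2)) ℂ,
      Implements (4 * N + 4 * K + 2) F ∧ ∀ O,
        (inputEmbed n b ((0 : Fin 2), (0 : Fin 2)))ᴴ *
            (F O * inputEmbed n b ((0 : Fin 2), (0 : Fin 2))) =
          (neighbours U O)ᴴ *
            ((walk U α O)ᴴ ^ K * aeval (walk U α O) (M 0 0) * neighbours U O) := by
  have hp := prepareGate_mem_unitaryGroup (b := b) hU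
  have hp' := Unitary.star_mem hp
  have hq := fun q => Implements.select_gate (n := n) (b := b) (W := Fin 2) q
  have h1 := Implements.unitary (select_mem_unitaryGroup hp hp)
  have h2 := Implements.unitary (select_mem_unitaryGroup hp' hp')
  have h3 := (implements_select_walk_conjTranspose α hU).pow K
  -- Four queries for each of the `N` controlled steps and the `K` inverse steps, and one each for
  -- preparing and unpreparing `neighbours`.
  refine ⟨_, ((h2.mul (hq .posnInv)).mul h3).mul ((implements_signalProcessing hU α hM).mul
    ((hq .posn).mul h1)) |>.congr (by ring) fun O => rfl, fun O => ?_⟩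
  rw [select_pow, select_mul, select_mul, select_mul, select, select, ← adjoinQubit_mul,
    ← adjoinQubit_mul, compress_adjoinQubit, diagonal_mul, mul_diagonal]
  have hT : (neighbours U O)ᴴ =
      (inputEmbed n b (0 : Fin 2))ᴴ * (star (prepareGate U) * O.gate .posnInv) := by
    rw [neighbours, prepareEmbed, conjTranspose_mul, conjTranspose_mul, conjTranspose_gate,
      Matrix.mul_assoc]
    rfl
  rw [hT]
  simp only [neighbours, prepareEmbed, Matrix.mul_assoc, cons_val_zero, map_apply]

end circuit

end HamSim

namespace HamSim

open Matrix Polynomial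

open scoped Matrix.Norms.L2Operator

variable {n b : ℕ}

/-! ### Error estimates -/

section estimates

variable {m l : Type} [Fintype m] [Fintype l] [DecidableEq l]

theorem norm_le_one_of_isometry [Nonempty l] {V : Matrix m l ℂ} (hV : Vᴴ * V = 1) : ‖V‖ ≤ 1 := by
  have h := l2_opNorm_conjTranspose_mul_self V
  rw [hV, CStarRing.norm_one] at h
  nlinarith [norm_nonneg V]

/-- An isometry whose compression is close to a unitary `E` is close to `E`. -/
theorem norm_isometry_sub_sq_le [Nonempty l] {V J : Matrix m l ℂ} {E D : Matrix l l ℂ}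
    (hV : Vᴴ * V = 1) (hJ : Jᴴ * J = 1) (hE : Eᴴ * E = 1) (hD : Jᴴ * V = E + D) :
    ‖V - J * E‖ ^ 2 ≤ 2 * ‖D‖ := by
  have hD' : Vᴴ * J = Eᴴ + Dᴴ := by
    simpa [conjTranspose_mul] using congrArg conjTranspose hD
  -- In `(V - JE)* (V - JE)` the four identity terms cancel, and only terms linear in `D` remain.
  have h : (V - J * E)ᴴ * (V - J * E) = -(Dᴴ * E + Eᴴ * D) := by
    have e1 : Vᴴ * (J * E) = 1 + Dᴴ * E := by
      rw [← Matrix.mul_assoc, hD', Matrix.add_mul, hE]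
    have e2 : Eᴴ * Jᴴ * V = 1 + Eᴴ * D := by
      rw [Matrix.mul_assoc, hD, Matrix.mul_add, hE]
    have e3 : Eᴴ * Jᴴ * (J * E) = 1 := by
      rw [Matrix.mul_assoc, ← Matrix.mul_assoc Jᴴ, hJ, Matrix.one_mul, hE]
    rw [conjTranspose_sub, conjTranspose_mul, Matrix.sub_mul, Matrix.mul_sub, Matrix.mul_sub, hV,
      e1, e2, e3]
    abel
  have hE1 := norm_le_one_of_isometry hE
  have hE2 : ‖Eᴴ‖ ≤ 1 := by rwa [l2_opNorm_conjTranspose]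
  rw [sq, ← l2_opNorm_conjTranspose_mul_self, h, norm_neg]
  calc ‖Dᴴ * E + Eᴴ * D‖ ≤ ‖Dᴴ * E‖ + ‖Eᴴ * D‖ := norm_add_le _ _
    _ ≤ ‖D‖ * 1 + 1 * ‖D‖ := by
      refine add_le_add ((l2_opNorm_mul _ _).trans ?_) ((l2_opNorm_mul _ _).trans ?_)
      · rw [l2_opNorm_conjTranspose]; gcongr
      · gcongr
    _ = 2 * ‖D‖ := by ring

end estimates

theorem matSpectralNorm_eq {m l : Type} [Fintype m] [Fintype l] [DecidableEq l]
    (M : Matrix m l ℂ) : matSpectralNorm M = ‖M‖ := rfl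

theorem evolution_isometry {H : Matrix (Label n) (Label n) ℂ} (hH : H.IsHermitian) (t : ℝ) :
    (evolution H t)ᴴ * evolution H t = 1 := by
  have h : ((-(Complex.I * (t : ℂ))) • H)ᴴ = -((-(Complex.I * (t : ℂ))) • H) := by
    rw [conjTranspose_smul, hH.eq]
    simp
  have hc := (Commute.refl ((-(Complex.I * (t : ℂ))) • H)).neg_left
  rw [evolution, ← exp_conjTranspose, h, ← Matrix.exp_add_of_commute _ _ hc, neg_add_cancel,
    NormedSpace.exp_zero]

theorem pow_mul_eq_mul_pow {m l : Type*} [Fintype m] [DecidableEq m] [Fintype l] [DecidableEq l]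
    {R : Matrix m m ℂ} {T : Matrix m l ℂ} {A : Matrix l l ℂ} (h : R * T = T * A) (k : ℕ) :
    R ^ k * T = T * A ^ k := by
  induction k with
  | zero => simp
  | succ k ih => rw [pow_succ, Matrix.mul_assoc, h, ← Matrix.mul_assoc, ih, Matrix.mul_assoc,
      ← pow_succ]

section compression

variable {U : Matrix (Label n) (Label n) ℂ} {α : Bits b → ℂ} {O : OracleData n b}

/-- The compression of the circuit is a truncated exponential of the encoded operator. -/
theorem compress_walk (hU : U ∈ unitaryGroup (Label n) ℂ)
    (hα : ∀ j k, α (O.h k j) = starRingEnd ℂ (α (O.h j k))) (c : ℂ) (τ : ℝ) (K : ℕ) :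
    (neighbours U O)ᴴ * ((walk U α O)ᴴ ^ K * aeval (walk U α O) (C c * cosineExp τ K) *
        neighbours U O) =
      c • ∑ k ∈ Finset.range (K + 1), (k.factorial : ℂ)⁻¹ • ((-(Complex.I * τ)) •
        ((neighbours U O)ᴴ * (flip α O * neighbours U O))) ^ k := by
  have hW := walk_mem_unitaryGroup α O hU
  have h1 := mem_unitaryGroup_iff.mp hW
  have h2 := mem_unitaryGroup_iff'.mp hW
  rw [star_eq_conjTranspose] at h1 h2
  have hT := neighbours_isometry O hU
  set A := (neighbours U O)ᴴ * (flip α O * neighbours U O) with hA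
  have h3 : ((-(Complex.I * τ) / 2) • (walk U α O + (walk U α O)ᴴ)) * neighbours U O =
      neighbours U O * ((-(Complex.I * τ)) • A) := by
    rw [Matrix.smul_mul, walk_add_conjTranspose_mul_neighbours hU hα, ← hA, Matrix.mul_smul,
      Matrix.mul_smul, smul_smul, div_mul_cancel₀ _ two_ne_zero]
  rw [map_mul, aeval_C, ← Algebra.smul_def, mul_smul_comm, pow_mul_aeval_cosineExp h1 h2,
    Matrix.smul_mul, Matrix.mul_smul, Matrix.sum_mul, Matrix.mul_sum]
  congr 1
  refine Finset.sum_congr rfl fun k _ => ?_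
  rw [Matrix.smul_mul, Matrix.mul_smul, pow_mul_eq_mul_pow h3, ← Matrix.mul_assoc, hT,
    Matrix.one_mul]

theorem norm_compress_flip_le (hU : U ∈ unitaryGroup (Label n) ℂ) :
    ‖(neighbours U O)ᴴ * (flip α O * neighbours U O)‖ ≤ 1 := by
  have hT := norm_le_one_of_isometry (neighbours_isometry O hU)
  have hS : ‖flip α O‖ ≤ 1 := by
    apply norm_le_one_of_isometry
    exact mem_unitaryGroup_iff'.mp (mul_mem swapGate_mem_unitaryGroup (mul_mem
      (gate_mem_unitaryGroup O _) (mul_mem (flagGate_mem_unitaryGroup α)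
      (gate_mem_unitaryGroup O _))))
  have hT' : ‖(neighbours U O)ᴴ‖ ≤ 1 := by rwa [l2_opNorm_conjTranspose]
  calc _ ≤ ‖(neighbours U O)ᴴ‖ * ‖flip α O * neighbours U O‖ := l2_opNorm_mul _ _
    _ ≤ ‖(neighbours U O)ᴴ‖ * (‖flip α O‖ * ‖neighbours U O‖) := by
      gcongr; exact l2_opNorm_mul _ _
    _ ≤ 1 * (1 * 1) := by gcongr
    _ = 1 := by norm_num

end compression

/-- One `δ` is the truncation error and `2δ` is the cost of the damping. -/
theorem norm_damped_sub_le {E S : Matrix (Label n) (Label n) ℂ} {δ : ℝ} (hδ : 0 < δ)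
    (hE : ‖E‖ ≤ 1) (h : ‖E - S‖ ≤ δ) : ‖(((1 + 2 * δ)⁻¹ : ℝ) : ℂ) • S - E‖ ≤ 3 * δ := by
  have h1 : 0 < 1 + 2 * δ := by positivity
  have h2 : (((1 + 2 * δ)⁻¹ : ℝ) : ℂ) • S - E =
      (((1 + 2 * δ)⁻¹ : ℝ) : ℂ) • (-(E - S) - ((2 * δ : ℝ) : ℂ) • E) := by
    have h3 : (((1 + 2 * δ)⁻¹ : ℝ) : ℂ) * (1 + ((2 * δ : ℝ) : ℂ)) = 1 := by
      rw [← Complex.ofReal_one, ← Complex.ofReal_add, ← Complex.ofReal_mul, inv_mul_cancel₀ h1.ne']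
    calc _ = (((1 + 2 * δ)⁻¹ : ℝ) : ℂ) • S -
          ((((1 + 2 * δ)⁻¹ : ℝ) : ℂ) * (1 + ((2 * δ : ℝ) : ℂ))) • E := by rw [h3, one_smul]
      _ = _ := by module
  rw [h2, norm_smul, Complex.norm_real, Real.norm_of_nonneg (by positivity)]
  calc _ ≤ 1 * (δ + 2 * δ * 1) := by
        gcongr
        · exact inv_le_one_of_one_le₀ (by linarith)
        · refine (norm_sub_le _ _).trans (add_le_add (by rwa [norm_neg]) ?_)
          rw [norm_smul, Complex.norm_real, Real.norm_of_nonneg (by positivity)]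
          gcongr
    _ = 3 * δ := by ring

/-- Simulation of a Hamiltonian that is encoded by the walk. -/
theorem exists_simulation {U : Matrix (Label n) (Label n) ℂ} (hU : U ∈ unitaryGroup (Label n) ℂ)
    (α : Bits b → ℂ) {τ ε : ℝ} (hτ : 0 ≤ τ) (hε : 0 < ε) {K : ℕ}
    (hK : Real.exp (Real.exp 1 * τ - (K + 1 : ℕ)) ≤ ε ^ 2 / 6) :
    ∃ A : QueryAlgorithm n b, A.queries = 12 * K + 2 ∧
      ∀ (H : Matrix (Label n) (Label n) ℂ) (O : OracleData n b) (t : ℝ), H.IsHermitian →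
        (∀ j k, α (O.h k j) = starRingEnd ℂ (α (O.h j k))) →
        (t : ℂ) • H = (τ : ℂ) • ((neighbours U O)ᴴ * (flip α O * neighbours U O)) →
        A.Simulates O H t ε := by
  -- With `δ = ε² / 6` the compression error is `3δ = ε² / 2`, and the squared distance of the
  -- isometries is at most twice that.
  obtain ⟨M, hM, hM0⟩ := exists_signalProcessing_cosineExp hτ (δ := ε ^ 2 / 6) (by positivity) hK
  obtain ⟨F, hF, hFc⟩ := exists_implements_compress hU α hM K
  obtain ⟨V, s, hs, hrun⟩ := hF.exists_queryAlgorithm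
  refine ⟨{ W := Fin 2 × Fin 2, w₀ := (0, 0), first := V, steps := s }, ?_, ?_⟩
  -- Here `N = 2K`, so the count is `4 · 2K + 4K + 2`.
  · rw [QueryAlgorithm.queries, hs]; ring
  · intro H O t hH hα hHA
    rw [QueryAlgorithm.Simulates, hrun, matSpectralNorm_eq]
    change ‖F O * inputEmbed n b ((0 : Fin 2), (0 : Fin 2)) -
      inputEmbed n b ((0 : Fin 2), (0 : Fin 2)) * evolution H t‖ ≤ ε
    have hFO := mem_unitaryGroup_iff'.mp (hF.mem_unitaryGroup O)
    rw [star_eq_conjTranspose] at hFO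
    have hJ := conjTranspose_inputEmbed_mul_self (n := n) (b := b) ((0 : Fin 2), (0 : Fin 2))
    have hV : (F O * inputEmbed n b ((0 : Fin 2), (0 : Fin 2)))ᴴ *
        (F O * inputEmbed n b ((0 : Fin 2), (0 : Fin 2))) = 1 := by
      rw [conjTranspose_mul, Matrix.mul_assoc, ← Matrix.mul_assoc (F O)ᴴ, hFO, Matrix.one_mul, hJ]
    have hE := evolution_isometry hH t
    set A := (neighbours U O)ᴴ * (flip α O * neighbours U O) with hA
    have hexp : evolution H t = NormedSpace.exp ((-(Complex.I * τ)) • A) := by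
      rw [evolution]
      congr 1
      calc _ = (-Complex.I) • ((t : ℂ) • H) := by module
        _ = _ := by rw [hHA]; module
    have hnorm : ‖(-(Complex.I * τ)) • A‖ ≤ τ := by
      rw [norm_smul, norm_neg, norm_mul, Complex.norm_I, one_mul, Complex.norm_real,
        Real.norm_of_nonneg hτ]
      exact mul_le_of_le_one_right hτ (norm_compress_flip_le hU)
    have htail := (norm_exp_sub_sum_le hnorm (K + 1)).trans hK
    rw [← hexp] at htail
    have hD := norm_damped_sub_le (by positivity) (norm_le_one_of_isometry hE) htail
    have hmain := norm_isometry_sub_sq_le hV hJ hE (D := _ - evolution H t)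
      ((hFc O).trans (by rw [hM0, compress_walk hU hα]; exact (add_sub_cancel _ _).symm))
    have : ‖F O * inputEmbed n b ((0 : Fin 2), (0 : Fin 2)) -
        inputEmbed n b ((0 : Fin 2), (0 : Fin 2)) * evolution H t‖ ^ 2 ≤ ε ^ 2 := by
      refine hmain.trans ?_
      linarith
    exact (sq_le_sq₀ (norm_nonneg _) hε.le).mp this

/-! ### Sparse Hamiltonians -/

theorem norm_apply_le_maxNorm (H : Matrix (Label n) (Label n) ℂ) (i j : Label n) :
    ‖H i j‖ ≤ maxNorm H :=
  le_ciSup (f := fun p : Label n × Label n => ‖H p.1 p.2‖) (Set.finite_range _).bddAbove (i, j)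

/-- The walk of a sparse Hamiltonian encodes it, up to normalization. -/
theorem sparse_eq_smul_compress {d : ℕ} {val : Bits b → ℂ} {H : Matrix (Label n) (Label n) ℂ}
    {O : OracleData n b} {D : ℕ} (hD : 0 < D) (hDd : min d (2 ^ n) = D)
    {U : Matrix (Label n) (Label n) ℂ}
    (hU : ∀ i : Label n, U i 0 = if (i : ℕ) < D then ((√D : ℝ) : ℂ)⁻¹ else 0)
    (hH : H.IsHermitian) (hO : O.Specifies val d H) :
    H = ((maxNorm H : ℂ) * D) • ((neighbours U O)ᴴ *
      (flip (fun z => starRingEnd ℂ (val z) / maxNorm H) O * neighbours U O)) := by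
  have hle : ∀ j k, ‖starRingEnd ℂ (val (O.h j k)) / (maxNorm H : ℂ)‖ ≤ 1 := by
    intro j k
    have h1 := norm_apply_le_maxNorm H j k
    rw [norm_div, RCLike.norm_conj, hO.value, Complex.norm_real,
      Real.norm_of_nonneg ((norm_nonneg _).trans h1)]
    exact div_le_one_of_le₀ h1 ((norm_nonneg _).trans h1)
  have hconj : ∀ i j, starRingEnd ℂ (H j i) = H i j := fun i j => hH.apply i j
  ext i j
  -- The `(i, j)` entry of the compression reads the string of row `j`, column `i`; the conjugate in
  -- the choice of `α` converts `H j i` into `H i j`.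
  rw [Matrix.smul_apply, compress_flip hle, hO.value, hconj]
  by_cases hij : H i j = 0
  · simp [hij]
  -- A nonzero entry is listed in row `i`, and by Hermiticity also in row `j`. The two amplitudes `1
  -- / √D` produce the factor `1 / D`.
  have hamp : ∀ i j, H i j ≠ 0 → U ((O.f i).symm j) 0 = ((√D : ℝ) : ℂ)⁻¹ := by
    intro i j hij
    obtain ⟨ℓ, hℓ, rfl⟩ := hO.position i j hij
    rw [Equiv.symm_apply_apply, hU, if_pos]
    rw [← hDd]
    exact lt_min hℓ ℓ.2
  have hji : H j i ≠ 0 := by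
    rw [← hconj]
    simpa using hij
  have hX : (maxNorm H : ℂ) ≠ 0 := by
    have := (norm_pos_iff.mpr hij).trans_le (norm_apply_le_maxNorm H i j)
    exact_mod_cast this.ne'
  have hs : ((√D : ℝ) : ℂ) ^ 2 = D := by
    have := Real.sq_sqrt (Nat.cast_nonneg (α := ℝ) D)
    exact_mod_cast this
  have hs0 : ((√D : ℝ) : ℂ) ≠ 0 := by
    intro h0
    rw [h0] at hs
    have : (D : ℂ) = 0 := by rw [← hs]; norm_num
    exact hD.ne' (by exact_mod_cast this)
  rw [hamp i j hij, hamp j i hji, smul_eq_mul, ← hs]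
  simp only [star_inv₀, RCLike.star_def, Complex.conj_ofReal]
  field_simp

theorem exists_uniform_unitary {D : ℕ} (hD : 0 < D) (hDn : D ≤ 2 ^ n) :
    ∃ U ∈ unitaryGroup (Label n) ℂ,
      ∀ i : Label n, U i 0 = if (i : ℕ) < D then ((√D : ℝ) : ℂ)⁻¹ else 0 := by
  refine exists_unitary_of_unit_column 0 _ ?_
  have h : ∀ i : Label n, ‖(if (i : ℕ) < D then ((√D : ℝ) : ℂ)⁻¹ else 0)‖ ^ 2 =
      if (i : ℕ) < D then (D : ℝ)⁻¹ else 0 := by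
    intro i
    split_ifs
    · rw [norm_inv, Complex.norm_real, Real.norm_of_nonneg (Real.sqrt_nonneg _), inv_pow,
        Real.sq_sqrt (Nat.cast_nonneg D)]
    · simp
  simp only [h]
  rw [Fin.sum_univ_eq_sum_range (fun i => if i < D then (D : ℝ)⁻¹ else 0) (2 ^ n),
    ← Finset.sum_filter]
  have : (Finset.range (2 ^ n)).filter (· < D) = Finset.range D := by
    ext i
    simp only [Finset.mem_filter, Finset.mem_range]
    omega
  rw [this, Finset.sum_const, Finset.card_range, nsmul_eq_mul, mul_inv_cancel₀]
  exact_mod_cast hD.ne'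

/-! ### Query count -/

/-- With `u = log τ'`, the slowly varying factor is `u / log u ≥ 1`, because `log u ≤ u - 1`. -/
theorem add_le_queryScale {τ : ℝ} (hτ : 0 ≤ τ) (ε : ℝ) :
    τ + max 1 (Real.log (1 / ε)) ≤ queryScale τ ε := by
  unfold queryScale
  simp only
  gcongr
  refine le_mul_of_one_le_right hτ ?_
  set u := Real.log (max τ (Real.exp (Real.exp 1))) with hu
  have h1 : Real.exp 1 ≤ u := by
    rw [hu, Real.le_log_iff_exp_le (by positivity)]
    exact le_max_right _ _
  have hu0 : 0 < u := (Real.exp_pos 1).trans_le h1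
  have h2 : 1 ≤ Real.log u := by rwa [Real.le_log_iff_exp_le hu0]
  rw [one_le_div (by linarith)]
  linarith [Real.log_le_sub_one_of_pos hu0]

/-- A truncation order of size `O(τ + log (1/ε))`. -/
theorem exists_order {σ τ ε : ℝ} (hσ : 0 ≤ σ) (hστ : σ ≤ τ) (hε : 0 < ε) :
    ∃ K : ℕ, Real.exp (Real.exp 1 * σ - (K + 1 : ℕ)) ≤ (min ε 1) ^ 2 / 6 ∧
      ((12 * K + 2 : ℕ) : ℝ) ≤ 62 * (τ + max 1 (Real.log (1 / ε))) := by
  have hε' : 0 < min ε 1 := lt_min hε one_pos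
  set L := max 1 (Real.log (1 / ε)) with hL
  have hL1 : 1 ≤ L := le_max_left _ _
  have hlog : -Real.log (min ε 1) ≤ L := by
    rcases min_choice ε 1 with h | h
    · rw [h, hL, one_div, Real.log_inv]; exact le_max_right _ _
    · rw [h, Real.log_one]; linarith
  have hlog0 : Real.log (min ε 1) ≤ 0 := Real.log_nonpos hε'.le (min_le_right _ _)
  have h6 : Real.log 6 ≤ 2 := by
    rw [Real.log_le_iff_le_exp (by norm_num)]
    have h1 := Real.exp_one_gt_d9
    have : Real.exp 2 = Real.exp 1 * Real.exp 1 := by rw [← Real.exp_add]; norm_num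
    nlinarith
  have h60 : 0 ≤ Real.log 6 := Real.log_nonneg (by norm_num)
  have he : Real.exp 1 ≤ 3 := by linarith [Real.exp_one_lt_d9]
  have hloge : Real.log ((min ε 1) ^ 2 / 6) = 2 * Real.log (min ε 1) - Real.log 6 := by
    rw [Real.log_div (by positivity) (by norm_num), Real.log_pow]; norm_num
  set x := Real.exp 1 * σ - Real.log ((min ε 1) ^ 2 / 6) with hx
  have hσe : Real.exp 1 * σ ≤ 3 * τ := by
    calc Real.exp 1 * σ ≤ 3 * σ := by gcongr
      _ ≤ 3 * τ := by gcongr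
  -- Capping the error at `1` keeps the logarithm nonpositive, so rounding `x` up to a natural
  -- number costs at most one.
  have hx0 : 0 ≤ x := by
    have : 0 ≤ Real.exp 1 * σ := by positivity
    rw [hx, hloge]; linarith
  refine ⟨⌈x⌉₊, ?_, ?_⟩
  · rw [← Real.le_log_iff_exp_le (by positivity)]
    have := Nat.le_ceil x
    push_cast
    linarith
  -- From `K ≤ 3τ + 2L + 3` the count is at most `36τ + 24L + 38`, and `L ≥ 1` absorbs the constant:
  -- `24 + 38 = 62`.
  · have := (Nat.ceil_lt_add_one hx0).le
    push_cast
    have : x ≤ 3 * τ + 2 * L + 2 := by rw [hx, hloge]; linarith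
    linarith

end HamSim

/-! ### Assembly of the main theorem -/

theorem theorem1 :
    ∃ C : ℝ, 0 < C ∧
      ∀ (n b d : ℕ) (val : HamSim.Bits b → ℂ) (X t ε : ℝ), 0 ≤ X → 0 ≤ t → 0 < ε →
        ∃ A : HamSim.QueryAlgorithm n b,
          (A.queries : ℝ) ≤ C * HamSim.queryScale (t * X * d) ε ∧
          ∀ (H : Matrix (HamSim.Label n) (HamSim.Label n) ℂ) (O : HamSim.OracleData n b),
            H.IsHermitian → HamSim.IsSparse d H → HamSim.maxNorm H = X →
            O.Specifies val d H → A.Simulates O H t ε := by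
  refine ⟨62, by norm_num, fun n b d val X t ε hX ht hε => ?_⟩
  have hτ : 0 ≤ t * X * d := by positivity
  have hscale := HamSim.add_le_queryScale hτ ε
  rcases Nat.eq_zero_or_pos d with rfl | hd
  -- For `d = 0` there is nothing to superpose, but then `H = 0` and the empty circuit is exact.
  · refine ⟨{ W := Unit, w₀ := (), first := 1, steps := [] }, ?_, ?_⟩
    · have : 1 ≤ max 1 (Real.log (1 / ε)) := le_max_left _ _
      simp only [HamSim.QueryAlgorithm.queries, List.length_nil, Nat.cast_zero]
      linarith
    · intro H O _ _ _ hO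
      have hH : H = 0 := by
        ext i j
        by_contra hij
        obtain ⟨ℓ, hℓ, -⟩ := hO.position i j hij
        exact absurd hℓ (Nat.not_lt_zero _)
      rw [HamSim.QueryAlgorithm.Simulates, HamSim.evolution, hH, smul_zero, NormedSpace.exp_zero]
      simpa [HamSim.QueryAlgorithm.run, HamSim.matSpectralNorm] using hε.le
  -- Only `2 ^ n` labels exist, so the superposition has `min d (2 ^ n)` terms even if `d` is
  -- larger.
  · set D := min d (2 ^ n) with hD
    have hD0 : 0 < D := lt_min hd (by positivity)
    have hDd : t * X * D ≤ t * X * d := by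
      gcongr
      exact min_le_left _ _
    obtain ⟨U, hU, hU0⟩ := HamSim.exists_uniform_unitary hD0 (min_le_right d (2 ^ n))
    obtain ⟨K, hK, hKq⟩ := HamSim.exists_order (by positivity) hDd hε
    obtain ⟨A, hA, hsim⟩ := HamSim.exists_simulation hU
      -- For `X = 0` division by zero gives `α = 0`, consistent with `H = 0`.
      (fun z : HamSim.Bits b => starRingEnd ℂ (val z) / X) (by positivity)
      (lt_min hε one_pos) hK
    refine ⟨A, ?_, fun H O hH _ hmax hO => ?_⟩
    · rw [hA]
      linarith
    · have h := hsim H O t hH (fun j k => ?_) ?_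
      · exact h.trans (min_le_left _ _)
      · have hjk : starRingEnd ℂ (H j k) = H k j := hH.apply k j
        simp only [hO.value, map_div₀, Complex.conj_conj, Complex.conj_ofReal, ← hjk]
      · have := HamSim.sparse_eq_smul_compress hD0 hD.symm hU0 hH hO
        rw [hmax] at this
        conv_lhs => rw [this]
        rw [smul_smul]
        push_cast
        ring_nf
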